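/- Let $M$ be a compact connected Kähler manifold of complex dimension $d$ with Kähler form $\omega$, let $0<q<1$ and let $m\ge 0$ be an integer. Write $[s]=\frac{q^{s}-q^{-s}}{q-q^{-1}}$. Let $(E_0,h_0),\dots,(E_m,h_m)$ be smooth hermitian vector bundles over $M$, where $E_0$ and $E_m$ have positive rank. For a unitary connection $\nabla$ on a hermitian bundle $E$ let $F_\nabla$ be its curvature and $F^\omega_\nabla=\sqrt{-1}\,\Lambda_\omega F_\nabla$ the (hermitian) component of the curvature along $\omega$, and put $$\deg(E)=\frac{1}{\mathrm{vol}_\omega(M)}\int_M \mathrm{tr}(F^\omega_\nabla)\,\frac{\omega^d}{d!},\qquad \mathrm{vol}_\omega(M)=\int_M\frac{\omega^d}{d!},\qquad \mu(E)=\frac{\deg(E)}{\mathrm{rank}(E)};$$ the statements below hold whichever unitary connection is used to compute the degrees. Put $$\mu_{q,m}(\underline{E})=\frac{\sum_{i=0}^m\big(\deg(E_i)-q^{m-2i+1}[m-2i]\,\mathrm{rank}(E_i)\big)}{\sum_{i=0}^m \mathrm{rank}(E_i)}.$$ Suppose given a stable $q$-quiver bundle, that is, integrable unitary connections $\nabla_i$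 on $(E_i,h_i)$ (meaning $F_{\nabla_i}^{0,2}=0$) for $i=0,\dots,m$ and smooth bundle morphisms $\phi_i:E_{i-1}\to E_i$ for $i=1,\dots,m$, with adjoints $\phi_i^*$ holomorphic for the holomorphic structures induced by the $\nabla_i$, satisfying the $q$-vortex equations $$F_{\nabla_i}^\omega=q^2\,\phi_i\circ\phi_i^*-\phi_{i+1}^*\circ\phi_{i+1}+q^{m-2i+1}[m-2i]\,\mathrm{id}_{E_i},\qquad i=0,1,\dots,m,$$ where $\phi_0=0$ and $\phi_{m+1}=0$. Then: (a) $\mu(E_0)\le q^{m+1}[m]$, with equality if and only if $E_0$ admits an integrable unitary connection $\nabla$ solving the hermitian Yang–Mills equation $F^\omega_{\nabla}=q^{m+1}[m]\,\mathrm{id}_{E_0}$; moreover, equality holds if and only if the given $\nabla_0$ solves this equation. (b) $\mu(E_m)\ge -q^{-m+1}[m]$, with equality if and only if $E_m$ admits an integrable unitary connection $\nabla$ solving $F^\omega_{\nabla}=-q^{-m+1}[m]\,\mathrm{id}_{E_m}$; moreover, equality holds if and only if the given $\nabla_m$ solves this equation. (c) $\mu_{q,m}(\underline{E})\le 0$,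 with equality if and only if, for each $i=0,\dots,m$, $E_i$ admits an integrable unitary connection $\nabla$ solving $F^\omega_{\nabla}=q^{m-2i+1}[m-2i]\,\mathrm{id}_{E_i}$; moreover, equality holds if and only if, for each $i$, the given $\nabla_i$ solves this equation. -/

import Mathlib

open Bundle Manifold Set Filter Topology MeasureTheory
open scoped ContDiff InnerProductSpace

universe u v w

noncomputable section

/-! ### Complex manifolds as real manifolds -/

section Base

variable {V : Type u} [NormedAddCommGroup V] [NormedSpace ℂ V]
  {M : Type v} [TopologicalSpace M] [ChartedSpace V M]

/-- A complex manifold is a real manifold with the same charts. -/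
instance complexManifold_isManifold_real [IsManifold 𝓘(ℂ, V) ω M] :
    IsManifold 𝓘(ℝ, V) ω M :=
  isManifold_of_contDiffOn 𝓘(ℝ, V) ω M fun e e' he he' => by
    have h := (contDiffGroupoid ω 𝓘(ℂ, V)).compatible he he'
    rw [contDiffGroupoid, mem_groupoid_of_pregroupoid] at h
    exact ContDiffOn.restrict_scalars (𝕜 := ℝ) (𝕜' := ℂ) h.1

variable (V) in
/-- The complex structure `J` on the real tangent space at `x`: Mathlib's `TangentSpace` at `x` is
`V`, identified through the preferred (holomorphic) chart at `x`, so `J` is multiplication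
by `i`. -/
def complexStructure (x : M) : TangentSpace 𝓘(ℝ, V) x →L[ℝ] TangentSpace 𝓘(ℝ, V) x :=
  ((Complex.I • ContinuousLinearMap.id ℂ V).restrictScalars ℝ : V →L[ℝ] V)

variable (V) in
/-- The differential at `y` of the inverse of the chart at `c`: it sends a vector `v` of the
coordinate space to the corresponding tangent vector of `M`. -/
def chartVector (c : M) (y v : V) : TangentSpace 𝓘(ℝ, V) ((chartAt V c).symm y) :=
  mfderiv 𝓘(ℝ, V) 𝓘(ℝ, V) (chartAt V c).symm y v

end Base

/-! ### Kähler metrics, volume and contraction with the Kähler form -/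

section Kahler

variable (V : Type u) [NormedAddCommGroup V] [NormedSpace ℂ V]
  (M : Type v) [TopologicalSpace M] [ChartedSpace V M] [IsManifold 𝓘(ℂ, V) ω M]

/-- A Kähler metric on a complex manifold: a smooth Riemannian metric `g` for which `J` is
orthogonal and whose fundamental form `ω(v, w) = g(J v, w)` is closed. Closedness `dω = 0` is
written in each chart, on constant coordinate vector fields. -/
structure KahlerMetric extends
    ContMDiffRiemannianMetric 𝓘(ℝ, V) ∞ V (TangentSpace 𝓘(ℝ, V) : M → Type u) where
  inner_J : ∀ (x : M) (v w : TangentSpace 𝓘(ℝ, V) x),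
    inner x (complexStructure V x v) (complexStructure V x w) = inner x v w
  closed : ∀ (c : M), ∀ y ∈ (chartAt V c).target, ∀ u₁ u₂ u₃ : V,
    let Ω : V → V → V → ℝ := fun v w z =>
      inner ((chartAt V c).symm z) (complexStructure V _ (chartVector V c z v))
        (chartVector V c z w)
    fderiv ℝ (Ω u₂ u₃) y u₁ + fderiv ℝ (Ω u₃ u₁) y u₂ + fderiv ℝ (Ω u₁ u₂) y u₃ = 0

namespace KahlerMetric

variable {V M} [FiniteDimensional ℂ V] (g : KahlerMetric V M)

/-- The Riemannian volume density `√det g` in the chart at `c`, in the coordinates of a real basis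
of `V`; it is the density of `ω ^ d / d!` with respect to the Lebesgue measure of that basis. -/
def chartDensity (c : M) (y : V) : ℝ :=
  √(Matrix.of fun k l => g.inner ((chartAt V c).symm y)
      (chartVector V c y (Module.finBasis ℝ V k))
      (chartVector V c y (Module.finBasis ℝ V l))).det

/-- The integral `∫_M f ω ^ d / d!`, computed with a smooth partition of unity subordinate to the
charts. -/
def integral [MeasurableSpace V] [BorelSpace V] [T2Space M] [SigmaCompactSpace M]
    (f : M → ℝ) : ℝ :=
  let ρ := Classical.choose
    (SmoothPartitionOfUnity.exists_isSubordinate_chartAt_source (M := M) 𝓘(ℝ, V))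
  ∑ᶠ c : M, ∫ y in (chartAt V c).target,
    ρ c ((chartAt V c).symm y) * f ((chartAt V c).symm y) * g.chartDensity c y
      ∂(Module.finBasis ℝ V).addHaar

/-- The Kähler volume `∫_M ω ^ d / d!`. -/
def vol [MeasurableSpace V] [BorelSpace V] [T2Space M] [SigmaCompactSpace M] : ℝ :=
  g.integral fun _ => 1

/-- The matrix of the metric at `x` in a real basis of the tangent space. -/
def gram (x : M) : Matrix (Fin (Module.finrank ℝ V)) (Fin (Module.finrank ℝ V)) ℝ :=
  Matrix.of fun k l => g.inner x (Module.finBasis ℝ V k : V) (Module.finBasis ℝ V l : V)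

/-- The contraction `Λ α = ½ ∑ gᵏˡ α(bₖ, J bₗ)` of a vector valued two-form `α` at `x` with the
Kähler form; equivalently `Λ α = ½ ∑ α(eₖ, J eₖ)` for a `g`-orthonormal real basis `e` of the
tangent space. It is adjoint to multiplication by `ω`, and `Λ ω = d`. -/
def contraction {W : Type w} [AddCommGroup W] [Module ℂ W] (x : M)
    (α : TangentSpace 𝓘(ℝ, V) x → TangentSpace 𝓘(ℝ, V) x → W) : W :=
  (1 / 2 : ℂ) • ∑ k, ∑ l, (((g.gram x)⁻¹ k l : ℝ) : ℂ) •
    α (Module.finBasis ℝ V k : V) (complexStructure V x (Module.finBasis ℝ V l : V))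

end KahlerMetric

end Kahler

/-! ### Hermitian vector bundles -/

/-- A smooth hermitian vector bundle over (the real manifold underlying) `M`: a complex vector
bundle with typical fibre `F`, smooth transition functions, and a hermitian inner product on the
fibres which varies smoothly. -/
structure HermitianBundle (V : Type u) [NormedAddCommGroup V] [NormedSpace ℂ V]
    (M : Type v) [TopologicalSpace M] [ChartedSpace V M] where
  F : Type w
  Fiber : M → Type w
  [normedF : NormedAddCommGroup F]
  [spaceF : NormedSpace ℂ F]
  [finF : FiniteDimensional ℂ F]
  [normedFiber : ∀ x, NormedAddCommGroup (Fiber x)]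
  [innerFiber : ∀ x, InnerProductSpace ℂ (Fiber x)]
  [topTotal : TopologicalSpace (TotalSpace F Fiber)]
  [fiberBundle : FiberBundle F Fiber]
  [vectorBundle : VectorBundle ℂ F Fiber]
  [vectorBundleReal : VectorBundle ℝ F Fiber]
  [smoothBundle : ContMDiffVectorBundle ∞ F Fiber 𝓘(ℝ, V)]
  smooth_inner : ∀ (σ τ : ∀ x, Fiber x) (x : M),
    ContMDiffAt 𝓘(ℝ, V) (𝓘(ℝ, V).prod 𝓘(ℝ, F)) ∞ (fun y => TotalSpace.mk' F y (σ y)) x →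
    ContMDiffAt 𝓘(ℝ, V) (𝓘(ℝ, V).prod 𝓘(ℝ, F)) ∞ (fun y => TotalSpace.mk' F y (τ y)) x →
    ContMDiffAt 𝓘(ℝ, V) 𝓘(ℝ, ℂ) ∞ (fun y => ⟪σ y, τ y⟫_ℂ) x

namespace HermitianBundle

attribute [instance] normedF spaceF finF normedFiber innerFiber topTotal fiberBundle vectorBundle
  vectorBundleReal smoothBundle

variable {V : Type u} [NormedAddCommGroup V] [NormedSpace ℂ V]
  {M : Type v} [TopologicalSpace M] [ChartedSpace V M] (E : HermitianBundle.{u, v, w} V M)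

/-- The rank of the bundle. -/
def rank : ℕ := Module.finrank ℂ E.F

instance (x : M) : FiniteDimensional ℂ (E.Fiber x) :=
  VectorBundle.finiteDimensional ℂ E.F E.Fiber x

/-- The section `σ` is smooth at `x`. -/
def SmoothAt (σ : ∀ x, E.Fiber x) (x : M) : Prop :=
  ContMDiffAt 𝓘(ℝ, V) (𝓘(ℝ, V).prod 𝓘(ℝ, E.F)) ∞ (fun y => TotalSpace.mk' E.F y (σ y)) x

/-- The section `σ` is differentiable at `x`. -/
def DiffAt (σ : ∀ x, E.Fiber x) (x : M) : Prop :=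
  MDifferentiableAt 𝓘(ℝ, V) (𝓘(ℝ, V).prod 𝓘(ℝ, E.F)) (fun y => TotalSpace.mk' E.F y (σ y)) x

variable {E}

lemma DiffAt.congr {σ τ : ∀ x, E.Fiber x} {x : M} (hσ : E.DiffAt σ x)
    (h : ∀ᶠ y in 𝓝 x, τ y = σ y) : E.DiffAt τ x :=
  MDifferentiableAt.congr_of_eventuallyEq hσ (h.mono fun y hy => congrArg (TotalSpace.mk' E.F y) hy)

lemma DiffAt.add {σ τ : ∀ x, E.Fiber x} {x : M} (hσ : E.DiffAt σ x) (hτ : E.DiffAt τ x) :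
    E.DiffAt (fun y => σ y + τ y) x :=
  mdifferentiableAt_add_section hσ hτ

lemma SmoothAt.diffAt {σ : ∀ x, E.Fiber x} {x : M} (hσ : E.SmoothAt σ x) : E.DiffAt σ x :=
  ContMDiffAt.mdifferentiableAt hσ (by simp)

lemma SmoothAt.eventually [IsManifold 𝓘(ℝ, V) ω M] {σ : ∀ x, E.Fiber x} {x : M}
    (hσ : E.SmoothAt σ x) : ∀ᶠ y in 𝓝 x, E.DiffAt σ y := by
  have h1 : ContMDiffAt 𝓘(ℝ, V) (𝓘(ℝ, V).prod 𝓘(ℝ, E.F)) 1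
      (fun y => TotalSpace.mk' E.F y (σ y)) x := ContMDiffAt.of_le hσ (by simp)
  exact ((contMDiffAt_iff_contMDiffAt_nhds (by simp)).1 h1).mono fun y hy =>
    hy.mdifferentiableAt (by simp)

variable (E) in
/-- The local section with value `e` at `x` which is constant in the preferred trivialization
at `x`. -/
def ext {x : M} (e : E.Fiber x) : ∀ y, E.Fiber y :=
  FiberBundle.extend E.F e

lemma smoothAt_ext {x : M} (e : E.Fiber x) : E.SmoothAt (E.ext e) x :=
  FiberBundle.contMDiffAt_extend 𝓘(ℝ, V) E.F e

lemma ext_add {x : M} (e e' : E.Fiber x) :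
    ∀ᶠ y in 𝓝 x, E.ext (e + e') y = E.ext e y + E.ext e' y := by
  let t := trivializationAt E.F E.Fiber x
  have hx : x ∈ t.baseSet := FiberBundle.mem_baseSet_trivializationAt' x
  filter_upwards [t.open_baseSet.mem_nhds hx] with y hy
  change t.symm y (t ⟨x, e + e'⟩).2 = t.symm y (t ⟨x, e⟩).2 + t.symm y (t ⟨x, e'⟩).2
  rw [(t.linear ℂ hx).map_add, ← t.coe_symmₗ (R := ℂ) hy, map_add]

lemma ext_smul {x : M} (c : ℂ) (e : E.Fiber x) :
    ∀ᶠ y in 𝓝 x, E.ext (c • e) y = c • E.ext e y := by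
  let t := trivializationAt E.F E.Fiber x
  have hx : x ∈ t.baseSet := FiberBundle.mem_baseSet_trivializationAt' x
  filter_upwards [t.open_baseSet.mem_nhds hx] with y hy
  change t.symm y (t ⟨x, c • e⟩).2 = c • t.symm y (t ⟨x, e⟩).2
  rw [(t.linear ℂ hx).map_smul, ← t.coe_symmₗ (R := ℂ) hy, map_smul]

end HermitianBundle

/-! ### Unitary connections and their curvature -/

section Connection

variable {V : Type u} [NormedAddCommGroup V] [NormedSpace ℂ V]
  {M : Type v} [TopologicalSpace M] [ChartedSpace V M] [IsManifold 𝓘(ℂ, V) ω M]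

/-- A smooth unitary connection on a hermitian vector bundle: a covariant derivative `∇` (with
`toFun σ x v` standing for `∇_v σ` at `x`) which maps smooth sections to smooth sections of `Hom(TM, E)`,
is complex linear, and is compatible with the hermitian metric. -/
structure UnitaryConnection (E : HermitianBundle.{u, v, w} V M) extends
    CovariantDerivative 𝓘(ℝ, V) E.F E.Fiber where
  smooth : ∀ (σ : ∀ x, E.Fiber x) (x : M), E.SmoothAt σ x →
    ContMDiffAt 𝓘(ℝ, V) (𝓘(ℝ, V).prod 𝓘(ℝ, V →L[ℝ] E.F)) ∞
      (fun y => (⟨y, toFun σ y⟩ :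
        TotalSpace (V →L[ℝ] E.F) fun y => TangentSpace 𝓘(ℝ, V) y →L[ℝ] E.Fiber y)) x
  map_smul : ∀ (c : ℂ) (σ : ∀ x, E.Fiber x) (x : M) (v : TangentSpace 𝓘(ℝ, V) x),
    E.DiffAt σ x → toFun (fun y => c • σ y) x v = c • toFun σ x v
  unitary : ∀ (σ τ : ∀ x, E.Fiber x) (x : M) (v : TangentSpace 𝓘(ℝ, V) x),
    E.DiffAt σ x → E.DiffAt τ x →
    mfderiv 𝓘(ℝ, V) 𝓘(ℝ, ℂ) (fun y => ⟪σ y, τ y⟫_ℂ) x v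
      = ⟪toFun σ x v, τ x⟫_ℂ + ⟪σ x, toFun τ x v⟫_ℂ

namespace UnitaryConnection

variable {E : HermitianBundle.{u, v, w} V M} (D : UnitaryConnection E)

/-- The expression `∇_X ∇_Y σ - ∇_Y ∇_X σ - ∇_[X, Y] σ` at `x`. -/
def curvatureSection (X Y : ∀ x : M, TangentSpace 𝓘(ℝ, V) x) (σ : ∀ x, E.Fiber x) (x : M) :
    E.Fiber x :=
  D.toFun (fun y => D.toFun σ y (Y y)) x (X x) - D.toFun (fun y => D.toFun σ y (X y)) x (Y x)
    - D.toFun σ x (VectorField.mlieBracket 𝓘(ℝ, V) X Y x)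

lemma toFun_congr {σ τ : ∀ x, E.Fiber x} {x : M} (hσ : E.DiffAt σ x) (hτ : E.DiffAt τ x)
    (h : ∀ᶠ y in 𝓝 x, σ y = τ y) : D.toFun σ x = D.toFun τ x :=
  D.isCovariantDerivativeOnUniv.congr_of_eventuallyEq hσ hτ univ_mem h

lemma toFun_add {σ τ : ∀ x, E.Fiber x} {x : M} (hσ : E.DiffAt σ x) (hτ : E.DiffAt τ x) :
    D.toFun (fun y => σ y + τ y) x = D.toFun σ x + D.toFun τ x :=
  D.isCovariantDerivativeOnUniv.add hσ hτ (mem_univ x)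

lemma smoothAt_toFun {σ : ∀ x, E.Fiber x} {x : M} (hσ : E.SmoothAt σ x) {k : ℕ∞ω}
    (hk : k ≤ ∞) {X : ∀ x : M, TangentSpace 𝓘(ℝ, V) x}
    (hX : ContMDiffAt 𝓘(ℝ, V) (𝓘(ℝ, V).prod 𝓘(ℝ, V)) k (fun y => TotalSpace.mk' V y (X y)) x) :
    ContMDiffAt 𝓘(ℝ, V) (𝓘(ℝ, V).prod 𝓘(ℝ, E.F)) k
      (fun y => TotalSpace.mk' E.F y (D.toFun σ y (X y))) x :=
  ContMDiffAt.clm_bundle_apply (F₁ := V) (F₂ := E.F) ((D.smooth σ x hσ).of_le hk) hX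

/-- Along a field constant in the preferred chart at `x`, the covariant derivative of a section
smooth at `x` is differentiable at `x`. -/
lemma diffAt_toFun {σ : ∀ x, E.Fiber x} {x : M} (hσ : E.SmoothAt σ x)
    (v : TangentSpace 𝓘(ℝ, V) x) :
    E.DiffAt (fun y => D.toFun σ y (FiberBundle.extend V v y)) x :=
  ContMDiffAt.mdifferentiableAt
    (D.smoothAt_toFun hσ le_rfl (FiberBundle.contMDiffAt_extend 𝓘(ℝ, V) V v)) (by simp)

/-- The curvature `F(v, w)`, an endomorphism of the fibre at `x`: on `e` it is
`∇_X ∇_Y σ - ∇_Y ∇_X σ - ∇_[X, Y] σ` at `x`, for any fields `X`, `Y` and any section `σ` extending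
`v`, `w` and `e`; here the extensions are constant in the preferred chart and trivialization. -/
def curvature (x : M) (v w : TangentSpace 𝓘(ℝ, V) x) : E.Fiber x →ₗ[ℂ] E.Fiber x where
  toFun e := D.curvatureSection (FiberBundle.extend V v) (FiberBundle.extend V w) (E.ext e) x
  map_add' e e' := by
    have key : ∀ v : TangentSpace 𝓘(ℝ, V) x, ∀ w : TangentSpace 𝓘(ℝ, V) x,
        D.toFun (fun y => D.toFun (E.ext (e + e')) y (FiberBundle.extend V v y)) x w =
        D.toFun (fun y => D.toFun (E.ext e) y (FiberBundle.extend V v y)) x w +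
        D.toFun (fun y => D.toFun (E.ext e') y (FiberBundle.extend V v y)) x w := by
      intro v w
      rw [← _root_.add_apply, ← D.toFun_add
        (D.diffAt_toFun (HermitianBundle.smoothAt_ext e) v)
        (D.diffAt_toFun (HermitianBundle.smoothAt_ext e') v)]
      refine congrArg (fun L => L w) (D.toFun_congr
        (D.diffAt_toFun (HermitianBundle.smoothAt_ext (e + e')) v)
        ((D.diffAt_toFun (HermitianBundle.smoothAt_ext e) v).add
          (D.diffAt_toFun (HermitianBundle.smoothAt_ext e') v)) ?_)
      filter_upwards [(HermitianBundle.smoothAt_ext e).eventually,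
        (HermitianBundle.smoothAt_ext e').eventually,
        (HermitianBundle.smoothAt_ext (e + e')).eventually,
        (HermitianBundle.ext_add e e').eventually_nhds] with y h1 h2 h3 h4
      rw [D.toFun_congr h3 (h1.add h2) h4, D.toFun_add h1 h2, _root_.add_apply]
    have key' : D.toFun (E.ext (e + e')) x = D.toFun (E.ext e) x + D.toFun (E.ext e') x := by
      have h1 := (HermitianBundle.smoothAt_ext e).diffAt
      have h2 := (HermitianBundle.smoothAt_ext e').diffAt
      rw [D.toFun_congr (HermitianBundle.smoothAt_ext (e + e')).diffAt (h1.add h2)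
        (HermitianBundle.ext_add e e'), D.toFun_add h1 h2]
    simp only [curvatureSection, key, key', _root_.add_apply]
    abel
  map_smul' c e := by
    have key : ∀ v : TangentSpace 𝓘(ℝ, V) x, ∀ w : TangentSpace 𝓘(ℝ, V) x,
        D.toFun (fun y => D.toFun (E.ext (c • e)) y (FiberBundle.extend V v y)) x w =
        c • D.toFun (fun y => D.toFun (E.ext e) y (FiberBundle.extend V v y)) x w := by
      intro v w
      have hev : ∀ᶠ y in 𝓝 x, c • D.toFun (E.ext e) y (FiberBundle.extend V v y) =
          D.toFun (E.ext (c • e)) y (FiberBundle.extend V v y) := by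
        filter_upwards [(HermitianBundle.smoothAt_ext e).eventually,
          (HermitianBundle.smoothAt_ext (c • e)).eventually,
          (HermitianBundle.ext_smul c e).eventually_nhds] with y h1 h2 h3
        rw [← D.map_smul c _ _ _ h1]
        exact congrArg (fun L => L (FiberBundle.extend V v y))
          (D.toFun_congr (h2.congr (h3.mono fun z hz => hz.symm)) h2
            (h3.mono fun z hz => hz.symm))
      have hd := D.diffAt_toFun (HermitianBundle.smoothAt_ext (c • e)) v
      rw [← D.map_smul c _ _ _ (D.diffAt_toFun (HermitianBundle.smoothAt_ext e) v)]
      exact congrArg (fun L => L w) (D.toFun_congr hd (hd.congr hev)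
        (hev.mono fun y hy => hy.symm))
    have key' : ∀ w : TangentSpace 𝓘(ℝ, V) x,
        D.toFun (E.ext (c • e)) x w = c • D.toFun (E.ext e) x w := by
      intro w
      have hd := (HermitianBundle.smoothAt_ext (c • e)).diffAt
      rw [← D.map_smul c _ _ _ (HermitianBundle.smoothAt_ext e).diffAt]
      exact congrArg (fun L => L w) (D.toFun_congr hd
        (hd.congr ((HermitianBundle.ext_smul c e).mono fun y hy => hy.symm))
        (HermitianBundle.ext_smul c e))
    simp only [curvatureSection, key, key', RingHom.id_apply, smul_sub]

/-- The connection is integrable, `F^{0,2} = 0`: the complex bilinear extension of the curvature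
vanishes on all pairs `v + i J v`, `w + i J w` of vectors of type `(0, 1)`. -/
def IsIntegrable : Prop :=
  ∀ (x : M) (v w : TangentSpace 𝓘(ℝ, V) x),
    D.curvature x v w - D.curvature x (complexStructure V x v) (complexStructure V x w)
      + Complex.I • (D.curvature x (complexStructure V x v) w
        + D.curvature x v (complexStructure V x w)) = 0

variable [FiniteDimensional ℂ V] (g : KahlerMetric V M)

/-- The component `F^ω = i Λ F` of the curvature along the Kähler form, a hermitian endomorphism
of each fibre. -/
def curvatureAlong (x : M) : E.Fiber x →ₗ[ℂ] E.Fiber x :=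
  Complex.I • g.contraction x (D.curvature x)

/-- The hermitian Yang-Mills equation `F^ω = c id` with real constant `c`. -/
def IsHermitianYangMills (c : ℝ) : Prop :=
  ∀ x : M, D.curvatureAlong g x = (c : ℂ) • LinearMap.id

variable [MeasurableSpace V] [BorelSpace V] [T2Space M] [SigmaCompactSpace M]

/-- `Top₁ = (F^ω, id) = ∫_M tr (F^ω) ω ^ d / d!`; the trace of `F^ω` is real. -/
def topOne : ℝ :=
  g.integral fun x => (LinearMap.trace ℂ (E.Fiber x) (D.curvatureAlong g x)).re

/-- The degree `Top₁ / vol` of the bundle, computed with the connection `D`. -/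
def degree : ℝ :=
  D.topOne g / g.vol

/-- The slope `deg / rank` of the bundle, computed with the connection `D`. -/
def slope : ℝ :=
  D.degree g / E.rank

end UnitaryConnection

end Connection

/-! ### Chains of bundles and the `q`-vortex equations -/

/-- The `q`-number `[s] = (q ^ s - q ^ (-s)) / (q - q⁻¹)`. -/
def qNumber (q : ℝ) (s : ℤ) : ℝ :=
  (q ^ s - q ^ (-s)) / (q - q⁻¹)

section Vortex

variable {V : Type u} [NormedAddCommGroup V] [NormedSpace ℂ V] [FiniteDimensional ℂ V]
  {M : Type v} [TopologicalSpace M] [ChartedSpace V M] [IsManifold 𝓘(ℂ, V) ω M]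

/-- A smooth morphism of complex vector bundles: a family of complex linear maps of the fibres
taking smooth sections to smooth sections. -/
structure BundleMorphism (E₁ E₂ : HermitianBundle.{u, v, w} V M) where
  toFun : ∀ x, E₁.Fiber x →ₗ[ℂ] E₂.Fiber x
  smooth : ∀ (σ : ∀ x, E₁.Fiber x) (x : M), E₁.SmoothAt σ x →
    E₂.SmoothAt (fun y => toFun y (σ y)) x

/-- The fibrewise adjoint `φ* : E₂ → E₁` of `φ : E₁ → E₂` is holomorphic for the connections `D₁`
and `D₂`: the `(0, 1)` part of `v ↦ φ* ∘ ∇_v - ∇_v ∘ φ*` vanishes on (local) sections of `E₂`. -/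
def BundleMorphism.AdjointHolomorphic {E₁ E₂ : HermitianBundle.{u, v, w} V M}
    (φ : BundleMorphism E₁ E₂) (D₁ : UnitaryConnection E₁) (D₂ : UnitaryConnection E₂) : Prop :=
  ∀ (σ : ∀ x, E₂.Fiber x) (x : M), E₂.SmoothAt σ x → ∀ v : TangentSpace 𝓘(ℝ, V) x,
    let δ : TangentSpace 𝓘(ℝ, V) x → E₁.Fiber x := fun v =>
      (φ.toFun x).adjoint (D₂.toFun σ x v) - D₁.toFun (fun y => (φ.toFun y).adjoint (σ y)) x v
    δ v + Complex.I • δ (complexStructure V x v) = 0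

variable {m : ℕ} {E : Fin (m + 1) → HermitianBundle.{u, v, w} V M}

/-- The endomorphism `φᵢ ∘ φᵢ*` of `Eᵢ`, where `φ₀ = 0`. The Higgs field `φⱼ₊₁ : Eⱼ → Eⱼ₊₁` is
stored as `φ j`. -/
def incoming (φ : ∀ j : Fin m, BundleMorphism (E j.castSucc) (E j.succ)) (i : Fin (m + 1))
    (x : M) : (E i).Fiber x →ₗ[ℂ] (E i).Fiber x :=
  Fin.cases (motive := fun i => (E i).Fiber x →ₗ[ℂ] (E i).Fiber x) 0
    (fun j => (φ j).toFun x ∘ₗ ((φ j).toFun x).adjoint) i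

/-- The endomorphism `φᵢ₊₁* ∘ φᵢ₊₁` of `Eᵢ`, where `φₘ₊₁ = 0`. -/
def outgoing (φ : ∀ j : Fin m, BundleMorphism (E j.castSucc) (E j.succ)) (i : Fin (m + 1))
    (x : M) : (E i).Fiber x →ₗ[ℂ] (E i).Fiber x :=
  Fin.lastCases (motive := fun i => (E i).Fiber x →ₗ[ℂ] (E i).Fiber x) 0
    (fun j => ((φ j).toFun x).adjoint ∘ₗ (φ j).toFun x) i

/-- The constant `q ^ (m - 2 i + 1) [m - 2 i]`. -/
def vortexConstant (q : ℝ) (m i : ℕ) : ℝ :=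
  q ^ ((m : ℤ) - 2 * i + 1) * qNumber q ((m : ℤ) - 2 * i)

/-- A solution of the holomorphic chain `q`-vortex equations (a stable `q`-quiver bundle):
integrable unitary connections `∇ᵢ` on `Eᵢ` and Higgs fields `φᵢ : Eᵢ₋₁ → Eᵢ` with holomorphic
adjoints such that
`F^ω(∇ᵢ) = q² φᵢ ∘ φᵢ* - φᵢ₊₁* ∘ φᵢ₊₁ + q ^ (m - 2 i + 1) [m - 2 i] id` for `i = 0, …, m`. -/
structure IsQVortex (g : KahlerMetric V M) (q : ℝ) (D : ∀ i, UnitaryConnection (E i))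
    (φ : ∀ j : Fin m, BundleMorphism (E j.castSucc) (E j.succ)) : Prop where
  integrable : ∀ i, (D i).IsIntegrable
  holomorphic : ∀ j : Fin m, (φ j).AdjointHolomorphic (D j.castSucc) (D j.succ)
  vortex : ∀ (i : Fin (m + 1)) (x : M),
    (D i).curvatureAlong g x = ((q ^ 2 : ℝ) : ℂ) • incoming φ i x - outgoing φ i x
      + (vortexConstant q m i : ℂ) • LinearMap.id

variable [MeasurableSpace V] [BorelSpace V] [T2Space M] [SigmaCompactSpace M]

/-- The `(q, m)`-degree `∑ᵢ (deg Eᵢ - q ^ (m - 2 i + 1) [m - 2 i] rank Eᵢ)`, computed with the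
connections `D i` on `E i`. -/
def qmDegree (g : KahlerMetric V M) (q : ℝ) (D : ∀ i, UnitaryConnection (E i)) : ℝ :=
  ∑ i : Fin (m + 1), ((D i).degree g - vortexConstant q m i * (E i).rank)

/-- The `(q, m)`-slope: the `(q, m)`-degree divided by the total rank. -/
def qmSlope (g : KahlerMetric V M) (q : ℝ) (D : ∀ i, UnitaryConnection (E i)) : ℝ :=
  qmDegree g q D / ∑ i : Fin (m + 1), ((E i).rank : ℝ)

end Vortex

end

/-! Taking the trace of the `i`-th vortex equation and integrating gives `deg Eᵢ = cᵢ rank Eᵢ + (q²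
‖φᵢ‖² - ‖φᵢ₊₁‖²) / vol`, where `cᵢ` is the vortex constant and `‖·‖` is the L² norm
(`IsQVortex.degree_eq`). At `i = 0` only the negative term survives and at `i = m` only the positive
one, which gives the two slope bounds. In the sum over `i` each arrow counts `q²` at its target and
`-1` at its source, so the total is `(q² - 1) ∑ ‖φⱼ‖² / vol ≤ 0` (`IsQVortex.qmDegree_eq`). Equality
makes the L² norms of the relevant Higgs fields vanish. Their pointwise norms are continuous and
nonnegative, so the fields vanish identically and the vortex equation becomes the hermitian
Yang-Mills equation.

Conversely, a Yang-Mills solution need not be the given connection. Its existence determines the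
degree only because the degree does not depend on the unitary connection
(`UnitaryConnection.topOne_eq_topOne`), and most of the file proves this. The argument is Chern-Weil
theory plus Stokes. For two connections `B`, `D`, the quadratic terms in the difference of
curvatures are traceless, so `tr F_B - tr F_D = d tr (B - D)` (`trace_curvature_sub`). Hence the
difference of the integrands is the Kähler contraction `Λ dα` of an exact real form.

That `Λ dα` integrates to zero is the only place where `dω = 0` enters. In a chart with metric
matrix `G` and complex structure matrix `K`, put `P = G⁻¹ Kᵀ`. Closedness makes the bivector density
`√det G · P` divergence free (the coordinate form of `d (ω ^ (d - 1)) = 0`), so `√det G · Λ dα` is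
the divergence of `√det G · P α`. Cutting `α` with a partition of unity reduces the claim to
divergences of compactly supported `C¹` fields on a vector space. -/

noncomputable section

/-! ### Matrix identities: skew cocycles, derivatives of determinant and inverse, change of basis.
-/

section LinearAlgebra

variable {ι : Type*} [Fintype ι]

/-- The pointwise identity behind `dω = 0 → d (ω ^ (d - 1)) = 0`, for the inverse `P` of a
nondegenerate skew matrix whose derivatives `Ω' k` satisfy the cocycle identity. -/
lemma sum_skew_cocycle (P : Matrix ι ι ℝ) (Ω' : ι → Matrix ι ι ℝ)
    (hP : ∀ i j, P j i = -P i j) (hΩ' : ∀ k i j, Ω' k j i = -Ω' k i j)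
    (hcl : ∀ a b c, Ω' a b c + Ω' b c a + Ω' c a b = 0) (j : ι) :
    ∑ k, ((P * Ω' k).trace / 2 * P k j - (P * Ω' k * P) k j) = 0 := by
  -- Contracting with the skew `P` sees only the part of `Ω' k a b` antisymmetric in `k, a`; the
  -- cocycle identity rewrites that part as `-Ω' b k a`, whence the factor one half.
  have h2 : ∀ b, ∑ k, ∑ a, P k a * Ω' k a b = - (1 / 2) * ∑ k, ∑ a, P k a * Ω' b k a := by
    intro b
    have e1 : ∑ k, ∑ a, P k a * Ω' k a b = ∑ k, ∑ a, -(P k a * Ω' a k b) := by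
      rw [Finset.sum_comm]
      exact Finset.sum_congr rfl fun k _ => Finset.sum_congr rfl fun a _ => by rw [hP]; ring
    have e2 : ∀ k a, P k a * Ω' k a b + -(P k a * Ω' a k b) = -(P k a * Ω' b k a) := by
      intro k a
      have := hcl k a b
      rw [hΩ' a k b] at this
      linear_combination P k a * this
    have e3 : 2 * ∑ k, ∑ a, P k a * Ω' k a b = - ∑ k, ∑ a, P k a * Ω' b k a := by
      rw [two_mul]
      nth_rewrite 2 [e1]
      rw [← Finset.sum_add_distrib, ← Finset.sum_neg_distrib]
      refine Finset.sum_congr rfl fun k _ => ?_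
      rw [← Finset.sum_add_distrib, ← Finset.sum_neg_distrib]
      exact Finset.sum_congr rfl fun a _ => e2 k a
    linarith
  have h3 : ∑ k, (P * Ω' k * P) k j = ∑ b, (∑ k, ∑ a, P k a * Ω' k a b) * P b j := by
    simp only [Matrix.mul_apply, Finset.sum_mul]
    rw [Finset.sum_comm]
  rw [Finset.sum_sub_distrib, h3, ← Finset.sum_sub_distrib]
  refine Finset.sum_eq_zero fun k _ => ?_
  rw [h2]
  have : (P * Ω' k).trace = - ∑ a, ∑ b, P a b * Ω' k a b := by
    simp only [Matrix.trace, Matrix.diag_apply, Matrix.mul_apply, ← Finset.sum_neg_distrib]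
    exact Finset.sum_congr rfl fun a _ => Finset.sum_congr rfl fun b _ => by rw [hΩ' k a b]; ring
  rw [this]
  ring

variable [DecidableEq ι]

/-- **Jacobi's formula** for the derivative of a determinant. -/
lemma HasDerivAt.matrix_det {A : ℝ → Matrix ι ι ℝ} {A' : Matrix ι ι ℝ} {t : ℝ}
    (h : ∀ i j, HasDerivAt (fun s => A s i j) (A' i j) t) :
    HasDerivAt (fun s => (A s).det) ((A t).adjugate * A').trace t := by
  have h1 : HasDerivAt (fun s => (A s).det)
      (∑ σ : Equiv.Perm ι, ((Equiv.Perm.sign σ : ℤ) : ℝ) *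
        ∑ i, (∏ j ∈ Finset.univ.erase i, A t (σ j) j) * A' (σ i) i) t := by
    simp only [Matrix.det_apply']
    refine HasDerivAt.fun_sum fun σ _ => HasDerivAt.const_mul _ ?_
    have := HasDerivAt.fun_finsetProd (u := Finset.univ) (f := fun j s => A s (σ j) j)
      (f' := fun j => A' (σ j) j) (x := t) (fun j _ => h _ _)
    simpa [smul_eq_mul] using this
  convert h1 using 1
  -- Cramer's rule: a diagonal entry of `adj A · A'` is the determinant with one column
  -- differentiated, which is one group of terms in the product rule for the Leibniz expansion.
  have h2 : ∀ i, ((A t).adjugate * A') i i = ((A t).updateCol i (fun k => A' k i)).det := by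
    intro i
    rw [← Matrix.cramer_apply, Matrix.cramer_eq_adjugate_mulVec]
    rfl
  simp only [Matrix.trace, Matrix.diag_apply, h2, Matrix.det_apply']
  rw [Finset.sum_comm]
  refine Finset.sum_congr rfl fun σ _ => ?_
  rw [Finset.mul_sum]
  refine Finset.sum_congr rfl fun i _ => ?_
  congr 1
  rw [← Finset.mul_prod_erase _ _ (Finset.mem_univ i), mul_comm]
  congr 1
  · exact Finset.prod_congr rfl fun j hj => by simp [Finset.ne_of_mem_erase hj]
  · simp

/-- The derivative of the inverse of a matrix. -/
lemma HasDerivAt.matrix_inv {A : ℝ → Matrix ι ι ℝ} {A' : Matrix ι ι ℝ} {t : ℝ}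
    (h : ∀ i j, HasDerivAt (fun s => A s i j) (A' i j) t) (hdet : IsUnit (A t).det) (i j : ι) :
    HasDerivAt (fun s => (A s)⁻¹ i j) (-((A t)⁻¹ * A' * (A t)⁻¹) i j) t := by
  -- A submultiplicative norm makes the matrices a Banach algebra, where the derivative of inversion
  -- is known; the entries are then read off.
  let _ : NormedRing (Matrix ι ι ℝ) := Matrix.linftyOpNormedRing
  let _ : NormedAlgebra ℝ (Matrix ι ι ℝ) := Matrix.linftyOpNormedAlgebra
  have hA : HasDerivAt A A' t := hasDerivAt_pi.2 fun i => hasDerivAt_pi.2 fun j => h i j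
  have hu : IsUnit (A t) := (Matrix.isUnit_iff_isUnit_det _).2 hdet
  obtain ⟨U, hU⟩ := hu
  have h1 := (hasFDerivAt_ringInverse (𝕜 := ℝ) U)
  rw [hU] at h1
  have h2 := h1.comp_hasDerivAt t hA
  have h3 := hasDerivAt_pi.1 (hasDerivAt_pi.1 h2 i) j
  have h4 : (↑U⁻¹ : Matrix ι ι ℝ) = (A t)⁻¹ := by
    rw [Matrix.coe_units_inv, hU]
  simpa [← Matrix.nonsing_inv_eq_ringInverse, h4] using h3

variable {V : Type*} [AddCommGroup V] [Module ℝ V]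

/-- The full contraction of a bilinear form `N` with the inverse of a nondegenerate bilinear
form `S` does not depend on the basis. -/
lemma sum_inv_mul_basis_change (b : Module.Basis ι ℝ V) (S N : V →ₗ[ℝ] V →ₗ[ℝ] ℝ) (L : V →ₗ[ℝ] V)
    (hL : IsUnit (LinearMap.toMatrix b b L).det) :
    ∑ k, ∑ l, (Matrix.of fun k l => S (L (b k)) (L (b l)))⁻¹ k l * N (L (b k)) (L (b l)) =
      ∑ k, ∑ l, (Matrix.of fun k l => S (b k) (b l))⁻¹ k l * N (b k) (b l) := by
  have key : ∀ T : V →ₗ[ℝ] V →ₗ[ℝ] ℝ, (Matrix.of fun k l => T (L (b k)) (L (b l))) =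
      (LinearMap.toMatrix b b L).transpose * (Matrix.of fun k l => T (b k) (b l)) *
        LinearMap.toMatrix b b L := by
    intro T
    have := LinearMap.toMatrix₂_compl₁₂ (R := ℝ) b b b b T L L
    ext k l
    have h := congrFun (congrFun this k) l
    simpa [LinearMap.toMatrix₂_apply, Matrix.mul_apply] using h
  have tr : ∀ X Y : Matrix ι ι ℝ, ∑ k, ∑ l, X k l * Y k l = (X.transpose * Y).trace := by
    intro X Y
    simp only [Matrix.trace, Matrix.diag_apply, Matrix.mul_apply, Matrix.transpose_apply]
    rw [Finset.sum_comm]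
  have e1 := tr (Matrix.of fun k l => S (L (b k)) (L (b l)))⁻¹
    (Matrix.of fun k l => N (L (b k)) (L (b l)))
  have e2 := tr (Matrix.of fun k l => S (b k) (b l))⁻¹ (Matrix.of fun k l => N (b k) (b l))
  simp only [Matrix.of_apply] at e1 e2
  rw [e1, e2, key S, key N]
  set A := LinearMap.toMatrix b b L
  set s := (Matrix.of fun k l => S (b k) (b l))
  set n := (Matrix.of fun k l => N (b k) (b l))
  rw [Matrix.mul_inv_rev, Matrix.mul_inv_rev, Matrix.transpose_mul, Matrix.transpose_mul,
    ← Matrix.transpose_nonsing_inv, Matrix.transpose_transpose]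
  have hA : A * A⁻¹ = 1 := Matrix.mul_nonsing_inv _ hL
  have hA' : (A⁻¹).transpose * A.transpose = 1 := by
    rw [← Matrix.transpose_mul, hA, Matrix.transpose_one]
  -- Both forms change by congruence with `A`, so in the trace the transposes cancel in the middle
  -- and the remaining factors cancel by cyclicity.
  calc (A⁻¹ * (s⁻¹).transpose * (A⁻¹).transpose * (A.transpose * n * A)).trace
      = (A⁻¹ * ((s⁻¹).transpose * ((A⁻¹).transpose * A.transpose) * n * A)).trace := by
        simp only [Matrix.mul_assoc]
    _ = ((s⁻¹).transpose * n * (A * A⁻¹)).trace := by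
        rw [hA', Matrix.mul_one, Matrix.trace_mul_comm, Matrix.mul_assoc]
    _ = _ := by rw [hA, Matrix.mul_one]

end LinearAlgebra

/-! ### The divergence identity equivalent to closedness of the fundamental form, in coordinates. -/

section FlatKahler

variable {ι : Type*} [Fintype ι] [DecidableEq ι]
  {V : Type*} [NormedAddCommGroup V] [NormedSpace ℝ V]

lemma ContDiffAt.matrix_det {G : V → Matrix ι ι ℝ} {y : V} {n : ℕ∞ω}
    (hG : ∀ i j, ContDiffAt ℝ n (fun z => G z i j) y) : ContDiffAt ℝ n (fun z => (G z).det) y := by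
  simp only [Matrix.det_apply']
  exact ContDiffAt.sum fun σ _ => contDiffAt_const.mul (contDiffAt_prod fun i _ => hG _ _)

lemma ContDiffAt.matrix_inv {G : V → Matrix ι ι ℝ} {y : V} {n : ℕ∞ω}
    (hG : ∀ i j, ContDiffAt ℝ n (fun z => G z i j) y) (hdet : (G y).det ≠ 0) (i j : ι) :
    ContDiffAt ℝ n (fun z => (G z)⁻¹ i j) y := by
  simp only [Matrix.inv_def, Ring.inverse_eq_inv', Matrix.smul_apply, smul_eq_mul,
    Matrix.adjugate_apply]
  refine ((ContDiffAt.matrix_det hG).inv hdet).mul (ContDiffAt.matrix_det fun k l => ?_)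
  by_cases hk : k = j
  · subst hk; simpa using contDiffAt_const
  · simpa [Matrix.updateRow_ne hk] using hG k l

lemma ContDiffAt.sqrt_det_mul_inv_mul {G : V → Matrix ι ι ℝ} {y : V} {n : ℕ∞ω}
    (hG : ∀ i j, ContDiffAt ℝ n (fun z => G z i j) y) (hdet : 0 < (G y).det) (K : Matrix ι ι ℝ)
    (i j : ι) :
    ContDiffAt ℝ n (fun z => √(G z).det * ((G z)⁻¹ * K) i j) y := by
  simp only [Matrix.mul_apply]
  exact ((ContDiffAt.matrix_det hG).sqrt hdet.ne').mul
    (ContDiffAt.sum fun k _ => (ContDiffAt.matrix_inv hG hdet.ne' i k).mul contDiffAt_const)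

/-- `P = G⁻¹ Kᵀ` satisfies `P (Kᵀ G) = -1`, so it is minus the inverse of the fundamental form
matrix, and the inverse of a skew matrix is skew. -/
lemma inv_mul_transpose_skew {G K : Matrix ι ι ℝ} (hu : IsUnit G.det) (hK : K * K = -1)
    (hskew : ∀ i j, (K.transpose * G) j i = -(K.transpose * G) i j) (i j : ι) :
    (G⁻¹ * K.transpose) j i = -(G⁻¹ * K.transpose) i j := by
  have hKt : K.transpose * K.transpose = -1 := by
    rw [← Matrix.transpose_mul, hK, Matrix.transpose_neg, Matrix.transpose_one]
  set P : Matrix ι ι ℝ := G⁻¹ * K.transpose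
  have hPΩ : P * (K.transpose * G) = -1 := by
    simp only [P]
    rw [Matrix.mul_assoc, ← Matrix.mul_assoc K.transpose, hKt, Matrix.neg_mul, Matrix.one_mul,
      Matrix.mul_neg, Matrix.nonsing_inv_mul _ hu]
  have h0 : (K.transpose * G).transpose = -(K.transpose * G) := by
    ext i j; exact hskew i j
  have h1 : (K.transpose * G) * P.transpose = 1 := by
    have := congrArg Matrix.transpose hPΩ
    rw [Matrix.transpose_mul, h0, Matrix.transpose_neg, Matrix.transpose_one, Matrix.neg_mul,
      neg_inj] at this
    exact this
  have h2 : P.transpose = -P := by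
    have : P * ((K.transpose * G) * P.transpose) = P := by rw [h1, Matrix.mul_one]
    rw [← Matrix.mul_assoc, hPΩ, Matrix.neg_mul, Matrix.one_mul] at this
    exact neg_eq_iff_eq_neg.1 this
  exact congrFun (congrFun h2 i) j

/-- For a metric `G`, hermitian with respect to the complex structure with matrix `K`, whose
fundamental form `Kᵀ G` is closed, the bivector density `√det G G⁻¹ Kᵀ` is divergence free. -/
lemma sum_fderiv_sqrt_det_mul_inv_mul {G : V → Matrix ι ι ℝ} {y : V}
    (hG : ∀ i j, ContDiffAt ℝ 1 (fun z => G z i j) y) (hdet : 0 < (G y).det) (K : Matrix ι ι ℝ)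
    (hK : K * K = -1) (hskew : ∀ᶠ z in 𝓝 y, ∀ i j, (K.transpose * G z) j i = -(K.transpose * G z) i j)
    (e : ι → V)
    (hcl : ∀ a b c, fderiv ℝ (fun z => (K.transpose * G z) b c) y (e a) +
      fderiv ℝ (fun z => (K.transpose * G z) c a) y (e b) +
      fderiv ℝ (fun z => (K.transpose * G z) a b) y (e c) = 0) (j : ι) :
    ∑ k, fderiv ℝ (fun z => √(G z).det * ((G z)⁻¹ * K.transpose) k j) y (e k) = 0 := by
  set G' : ι → Matrix ι ι ℝ := fun k => Matrix.of fun i j => fderiv ℝ (fun z => G z i j) y (e k)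
  have hKt : K.transpose * K.transpose = -1 := by
    rw [← Matrix.transpose_mul, hK, Matrix.transpose_neg, Matrix.transpose_one]
  set P : Matrix ι ι ℝ := (G y)⁻¹ * K.transpose
  have hu : IsUnit (G y).det := hdet.ne'.isUnit
  -- Partial derivatives are computed along lines, so that the one-variable formulas for determinant
  -- and inverse apply.
  have line : ∀ k, HasDerivAt (fun t : ℝ => y + t • e k) (e k) 0 := fun k => by
    simpa using ((hasDerivAt_id (0 : ℝ)).smul_const (e k)).const_add y
  have hder : ∀ {f : V → ℝ}, ContDiffAt ℝ 1 f y → ∀ k,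
      HasDerivAt (fun t : ℝ => f (y + t • e k)) (fderiv ℝ f y (e k)) 0 := by
    intro f hf k
    have h1 : HasFDerivAt f (fderiv ℝ f y) (y + (0 : ℝ) • e k) := by
      simpa using (hf.differentiableAt (by simp)).hasFDerivAt
    exact h1.comp_hasDerivAt 0 (line k)
  have hΩc : ∀ i j, ContDiffAt ℝ 1 (fun z => (K.transpose * G z) i j) y := fun i j => by
    simp only [Matrix.mul_apply]
    exact ContDiffAt.sum fun k _ => contDiffAt_const.mul (hG _ _)
  have hΩ' : ∀ k i j, fderiv ℝ (fun z => (K.transpose * G z) i j) y (e k) =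
      (K.transpose * G' k) i j := by
    intro k i j
    refine (hder (hΩc i j) k).unique ?_
    simp only [Matrix.mul_apply]
    exact HasDerivAt.fun_sum fun l _ => (hder (hG l j) k).const_mul _
  have hΩ'skew : ∀ k i j, (K.transpose * G' k) j i = -(K.transpose * G' k) i j := by
    intro k i j
    rw [← hΩ', ← hΩ']
    have : (fun z => (K.transpose * G z) j i) =ᶠ[𝓝 y] fun z => -(K.transpose * G z) i j :=
      hskew.mono fun z hz => hz i j
    rw [this.fderiv_eq, fderiv_fun_neg]
    rfl
  have hPskew : ∀ i j, P j i = -P i j :=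
    inv_mul_transpose_skew hu hK hskew.self_of_nhds
  have main := sum_skew_cocycle P (fun k => K.transpose * G' k) hPskew hΩ'skew
    (fun a b c => by rw [← hΩ', ← hΩ', ← hΩ']; exact hcl a b c) j
  -- The product rule uses `(√det G)' = √det G · tr (G⁻¹ G') / 2` and `(G⁻¹)' = -G⁻¹ G' G⁻¹`.
  -- Replacing `G⁻¹ G'` by `-P (Kᵀ G')` brings in the derivatives of the fundamental form and
  -- produces the summand of `sum_skew_cocycle`.
  have hval : ∀ k, fderiv ℝ (fun z => √(G z).det * ((G z)⁻¹ * K.transpose) k j) y (e k) =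
      -√(G y).det * ((P * (K.transpose * G' k)).trace / 2 * P k j -
        (P * (K.transpose * G' k) * P) k j) := by
    intro k
    refine (hder (ContDiffAt.sqrt_det_mul_inv_mul hG hdet K.transpose k j) k).unique ?_
    have hline : ∀ i j, HasDerivAt (fun t : ℝ => G (y + t • e k) i j) (G' k i j) 0 :=
      fun i j => hder (hG i j) k
    have y0 : y + (0 : ℝ) • e k = y := by simp
    have hd := HasDerivAt.matrix_det hline
    have hs := hd.sqrt (by rw [y0]; exact hdet.ne')
    have hi : HasDerivAt (fun t : ℝ => ((G (y + t • e k))⁻¹ * K.transpose) k j)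
        ((-((G y)⁻¹ * G' k * (G y)⁻¹) * K.transpose) k j) 0 := by
      simp only [Matrix.mul_apply (M := (G _)⁻¹), Matrix.mul_apply (M := -_)]
      refine HasDerivAt.fun_sum fun l _ => HasDerivAt.mul_const ?_ _
      have := HasDerivAt.matrix_inv hline (by rw [y0]; exact hu) k l
      rw [y0] at this
      exact this
    refine (hs.mul hi).congr_deriv ?_
    rw [y0]
    have hadj : (G y).adjugate = (G y).det • (G y)⁻¹ := by
      rw [Matrix.inv_def, Ring.inverse_eq_inv', smul_smul, mul_inv_cancel₀ hdet.ne', one_smul]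
    have hPG : P * (K.transpose * G' k) = -((G y)⁻¹ * G' k) := by
      simp only [P]
      rw [Matrix.mul_assoc, ← Matrix.mul_assoc K.transpose, hKt, Matrix.neg_mul, Matrix.one_mul,
        Matrix.mul_neg]
    rw [hPG, hadj, Matrix.smul_mul, Matrix.trace_smul, Matrix.trace_neg, Matrix.neg_mul,
      Matrix.neg_mul, Matrix.mul_assoc ((G y)⁻¹ * G' k)]
    have hsq : √(G y).det ≠ 0 := (Real.sqrt_pos.2 hdet).ne'
    have hdd : (G y).det = √(G y).det * √(G y).det := (Real.mul_self_sqrt hdet.le).symm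
    simp only [Matrix.neg_apply, smul_eq_mul]
    change _ * P k j + √(G y).det * -((G y)⁻¹ * G' k * P) k j = _
    have : (G y).det * ((G y)⁻¹ * G' k).trace / (2 * √(G y).det) =
        √(G y).det * ((G y)⁻¹ * G' k).trace / 2 := by
      field_simp
      rw [sq, ← hdd]
      ring
    rw [this]
    ring
  rw [Finset.sum_congr rfl fun k _ => hval k, ← Finset.mul_sum, main, mul_zero]

end FlatKahler

/-! ### Differentials of charts and coordinate vector fields. -/

section ChartGeometry

variable {V : Type u} [NormedAddCommGroup V] [NormedSpace ℂ V]
  {M : Type v} [TopologicalSpace M] [ChartedSpace V M]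

/-- The differential of the inverse of the chart at `c`, as an endomorphism of the model space. -/
def chartDeriv (c : M) (y : V) : V →L[ℝ] V :=
  mfderiv 𝓘(ℝ, V) 𝓘(ℝ, V) (chartAt V c).symm y

lemma chartVector_eq (c : M) (y v : V) : chartVector V c y v = chartDeriv c y v := rfl

variable [IsManifold 𝓘(ℂ, V) ω M]

lemma isManifold_real_of_complex (n : ℕ∞ω) : IsManifold 𝓘(ℝ, V) n M :=
  IsManifold.of_le (n := ω) le_top

lemma contDiffAt_chart_trans (c c' : M) {y : V} (hy : y ∈ (chartAt V c).target)
    (hy' : (chartAt V c).symm y ∈ (chartAt V c').source) :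
    ContDiffAt ℂ ω (chartAt V c' ∘ (chartAt V c).symm) y := by
  have h := (contDiffGroupoid ω 𝓘(ℂ, V)).compatible (chart_mem_atlas V c) (chart_mem_atlas V c')
  rw [contDiffGroupoid, mem_groupoid_of_pregroupoid] at h
  have h1 := h.1
  simp only [contDiffPregroupoid, modelWithCornersSelf_coe,
    modelWithCornersSelf_coe_symm, Function.comp_id, Function.id_comp, range_id, inter_univ,
    preimage_id_eq, id_eq] at h1
  exact h1.contDiffAt (((chartAt V c).symm.trans (chartAt V c')).open_source.mem_nhds ⟨hy, hy'⟩)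

lemma contDiffAt_chart_trans_real (c c' : M) {y : V} (hy : y ∈ (chartAt V c).target)
    (hy' : (chartAt V c).symm y ∈ (chartAt V c').source) :
    ContDiffAt ℝ ω (chartAt V c' ∘ (chartAt V c).symm) y :=
  (contDiffAt_chart_trans c c' hy hy').restrict_scalars ℝ

lemma contMDiffAt_chart_symm (c : M) {y : V} (hy : y ∈ (chartAt V c).target) :
    ContMDiffAt 𝓘(ℝ, V) 𝓘(ℝ, V) ω (chartAt V c).symm y :=
  (contMDiffOn_chart_symm (I := 𝓘(ℝ, V)) (n := ω)).contMDiffAt ((chartAt V c).open_target.mem_nhds hy)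

lemma mdifferentiableAt_chart_symm (c : M) {y : V} (hy : y ∈ (chartAt V c).target) :
    MDifferentiableAt 𝓘(ℝ, V) 𝓘(ℝ, V) (chartAt V c).symm y :=
  (contMDiffAt_chart_symm c hy).mdifferentiableAt (by simp)

/-- The tangent space at a point is read through that point's preferred chart, so the differential
of an inverse chart is the differential of a transition map. Complex linearity and invertibility
follow from this. -/
lemma chartDeriv_eq_fderiv (c : M) {y : V} (hy : y ∈ (chartAt V c).target) :
    chartDeriv c y = fderiv ℝ (chartAt V ((chartAt V c).symm y) ∘ (chartAt V c).symm) y := by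
  rw [chartDeriv, (mdifferentiableAt_chart_symm c hy).mfderiv]
  simp [writtenInExtChartAt, mfld_simps]
  rfl

lemma chartDeriv_I_smul (c : M) {y : V} (hy : y ∈ (chartAt V c).target) (v : V) :
    chartDeriv c y (Complex.I • v) = Complex.I • chartDeriv c y v := by
  rw [chartDeriv_eq_fderiv c hy]
  have h := (contDiffAt_chart_trans c ((chartAt V c).symm y) hy (mem_chart_source V _)).differentiableAt
    (by simp)
  rw [h.fderiv_restrictScalars ℝ]
  simp

lemma chartDeriv_trans (c c' : M) {y : V} (hy : y ∈ (chartAt V c).target)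
    (hy' : (chartAt V c).symm y ∈ (chartAt V c').source) :
    chartDeriv c y = (chartDeriv c' (chartAt V c' ((chartAt V c).symm y))).comp
      (fderiv ℝ (chartAt V c' ∘ (chartAt V c).symm) y) := by
  have h1 : (chartAt V c).symm =ᶠ[𝓝 y] (chartAt V c').symm ∘ (chartAt V c' ∘ (chartAt V c).symm) := by
    filter_upwards [((chartAt V c).symm.trans (chartAt V c')).open_source.mem_nhds ⟨hy, hy'⟩] with z hz
    exact ((chartAt V c').left_inv hz.2).symm
  have h2 : MDifferentiableAt 𝓘(ℝ, V) 𝓘(ℝ, V) (chartAt V c' ∘ (chartAt V c).symm) y :=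
    ((contDiffAt_chart_trans_real c c' hy hy').differentiableAt (by simp)).mdifferentiableAt
  have h3 : MDifferentiableAt 𝓘(ℝ, V) 𝓘(ℝ, V) (chartAt V c').symm
      ((chartAt V c' ∘ (chartAt V c).symm) y) :=
    mdifferentiableAt_chart_symm c' ((chartAt V c').map_source hy')
  rw [chartDeriv, h1.mfderiv_eq, mfderiv_comp y h3 h2, mfderiv_eq_fderiv]
  rfl

lemma fderiv_chart_trans_comp (c c' : M) {y : V} (hy : y ∈ (chartAt V c).target)
    (hy' : (chartAt V c).symm y ∈ (chartAt V c').source) :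
    (fderiv ℝ (chartAt V c ∘ (chartAt V c').symm) (chartAt V c' ((chartAt V c).symm y))).comp
      (fderiv ℝ (chartAt V c' ∘ (chartAt V c).symm) y) = ContinuousLinearMap.id ℝ V := by
  have h0 : (chartAt V c').symm (chartAt V c' ((chartAt V c).symm y)) = (chartAt V c).symm y :=
    (chartAt V c').left_inv hy'
  have h1 : (chartAt V c ∘ (chartAt V c').symm) ∘ (chartAt V c' ∘ (chartAt V c).symm) =ᶠ[𝓝 y] id := by
    filter_upwards [((chartAt V c).symm.trans (chartAt V c')).open_source.mem_nhds ⟨hy, hy'⟩] with z hz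
    simp only [Function.comp_apply, id_eq]
    rw [(chartAt V c').left_inv (show (chartAt V c).symm z ∈ _ from hz.2)]
    exact (chartAt V c).right_inv hz.1
  have h2 := (contDiffAt_chart_trans_real c c' hy hy').differentiableAt (by simp)
  have h3 : DifferentiableAt ℝ (chartAt V c ∘ (chartAt V c').symm)
      ((chartAt V c' ∘ (chartAt V c).symm) y) :=
    (contDiffAt_chart_trans_real c' c ((chartAt V c').map_source hy')
      (by rw [h0]; exact (chartAt V c).map_target hy)).differentiableAt (by simp)
  have := fderiv_comp y h3 h2
  rw [h1.fderiv_eq, fderiv_id] at this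
  exact this.symm

/-- The differential of the inverse of a chart is invertible. -/
lemma exists_chartDeriv_inverse (c : M) {y : V} (hy : y ∈ (chartAt V c).target) :
    ∃ K : V →L[ℝ] V, K.comp (chartDeriv c y) = ContinuousLinearMap.id ℝ V ∧
      (chartDeriv c y).comp K = ContinuousLinearMap.id ℝ V := by
  set x := (chartAt V c).symm y
  have hx : x ∈ (chartAt V c).source := (chartAt V c).map_target hy
  have hcx : chartAt V c x = y := (chartAt V c).right_inv hy
  have e1 : (chartAt V x).symm (chartAt V x x) = x := (chartAt V x).left_inv (mem_chart_source V x)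
  rw [chartDeriv_eq_fderiv c hy]
  refine ⟨_, fderiv_chart_trans_comp c x hy (mem_chart_source V x), ?_⟩
  have := fderiv_chart_trans_comp x c (mem_chart_target V x) (by rw [e1]; exact hx)
  rw [e1, hcx] at this
  exact this

lemma chartDeriv_injective (c : M) {y : V} (hy : y ∈ (chartAt V c).target) :
    Function.Injective (chartDeriv c y) := by
  obtain ⟨K, hK, -⟩ := exists_chartDeriv_inverse c hy
  exact Function.LeftInverse.injective (g := K) fun v => congrArg (fun f : V →L[ℝ] V => f v) hK

lemma isUnit_det_chartDeriv {ι : Type*} [Fintype ι] [DecidableEq ι] (b : Module.Basis ι ℝ V)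
    (c : M) {y : V} (hy : y ∈ (chartAt V c).target) :
    IsUnit (LinearMap.toMatrix b b (chartDeriv c y : V →ₗ[ℝ] V)).det := by
  obtain ⟨K, hK, -⟩ := exists_chartDeriv_inverse c hy
  have h : LinearMap.toMatrix b b (K : V →ₗ[ℝ] V) *
      LinearMap.toMatrix b b (chartDeriv c y : V →ₗ[ℝ] V) = 1 := by
    rw [← LinearMap.toMatrix_comp]
    have : (K : V →ₗ[ℝ] V) ∘ₗ (chartDeriv c y : V →ₗ[ℝ] V) = LinearMap.id := by
      ext v; exact congrArg (fun f : V →L[ℝ] V => f v) hK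
    rw [this, LinearMap.toMatrix_id]
  exact Matrix.isUnit_det_of_left_inverse h

/-- The coordinate vector field of the chart at `c` with coordinates `v` is smooth. -/
lemma contMDiffAt_chartVector (c : M) {y : V} (hy : y ∈ (chartAt V c).target) (v : V) :
    ContMDiffAt 𝓘(ℝ, V) (𝓘(ℝ, V).prod 𝓘(ℝ, V)) ∞
      (fun z => (TotalSpace.mk' V ((chartAt V c).symm z) (chartVector V c z v) :
        TotalSpace V (TangentSpace 𝓘(ℝ, V) : M → Type u))) y := by
  have : IsManifold 𝓘(ℝ, V) 1 M := isManifold_real_of_complex 1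
  have h := ((contMDiffOn_chart_symm (I := 𝓘(ℝ, V)) (n := ω) (x := c)).contMDiffOn_tangentMapWithin
    (m := ∞) (by simp) (chartAt V c).open_target.uniqueMDiffOn)
  have h2 : ContMDiffAt 𝓘(ℝ, V) (𝓘(ℝ, V).prod 𝓘(ℝ, V)) ∞
      (fun z : V => (⟨z, v⟩ : TangentBundle 𝓘(ℝ, V) V)) y :=
    contMDiffAt_vectorSpace_iff_contDiffAt.2 contDiffAt_const
  have h3 := (h.contMDiffAt (x := (⟨y, v⟩ : TangentBundle 𝓘(ℝ, V) V)) (by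
    refine IsOpen.mem_nhds ((chartAt V c).open_target.preimage
      (FiberBundle.continuous_proj V (TangentSpace 𝓘(ℝ, V)))) ?_
    exact hy)).comp y h2
  refine h3.congr_of_eventuallyEq ?_
  filter_upwards [(chartAt V c).open_target.mem_nhds hy] with z hz
  simp only [Function.comp_apply, tangentMapWithin, chartVector]
  rw [mfderivWithin_of_isOpen (chartAt V c).open_target hz]

/-- The tangent trivialization at `x` is the differential of the chart at `x`. Thus the extensions
used to define curvature are coordinate fields: they commute, and derivatives along them are partial
derivatives. -/
lemma extend_tangent_eq {x p : M} (hp : p ∈ (chartAt V x).source) (v : TangentSpace 𝓘(ℝ, V) x) :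
    FiberBundle.extend V v p = chartDeriv x (chartAt V x p) v := by
  have : IsManifold 𝓘(ℝ, V) 1 M := isManifold_real_of_complex 1
  have h1 : (trivializationAt V (TangentSpace 𝓘(ℝ, V)) x ⟨x, v⟩).2 = v := by
    rw [TangentBundle.trivializationAt_eq_localTriv]
    exact (tangentBundleCore 𝓘(ℝ, V) M).coordChange_self (achart V x) x (mem_chart_source V x) v
  have h2 := TangentBundle.symmL_trivializationAt (I := 𝓘(ℝ, V)) hp
  have h3 : (trivializationAt V (TangentSpace 𝓘(ℝ, V)) x).symm p (v : V) =
      chartDeriv x (chartAt V x p) (v : V) := by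
    have := congrArg (fun f : V →L[ℝ] V => f (v : V)) h2
    refine Eq.trans (Trivialization.symmL_apply (R := ℝ) _ hp _).symm (Eq.trans this ?_)
    simp [chartDeriv, mfld_simps]
    rfl
  rw [FiberBundle.extend, h1]
  exact h3

end ChartGeometry

/-! ### Real one-forms and their exterior derivative. -/

section FormGeometry

variable {V : Type u} [NormedAddCommGroup V] [NormedSpace ℂ V]
  {M : Type v} [TopologicalSpace M] [ChartedSpace V M]

/-- The coordinate expression of a real one-form in the chart at `c`. -/
def chartForm (α : M → V →L[ℝ] ℝ) (c : M) (y : V) : V →L[ℝ] ℝ :=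
  (α ((chartAt V c).symm y)).comp (chartDeriv c y)

/-- A real one-form whose coordinate expressions are of class `C¹`. -/
def IsC1Form (α : M → V →L[ℝ] ℝ) : Prop :=
  ∀ c : M, ∀ y ∈ (chartAt V c).target, ContDiffAt ℝ 1 (chartForm α c) y

/-- The exterior derivative of a real one-form in the chart at `c`. -/
def chartExtD (α : M → V →L[ℝ] ℝ) (c : M) (y : V) : V →L[ℝ] V →L[ℝ] ℝ :=
  fderiv ℝ (chartForm α c) y - (fderiv ℝ (chartForm α c) y).flip

/-- The exterior derivative of a real one-form, computed at each point in the preferred chart. -/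
def formExtD (α : M → V →L[ℝ] ℝ) (x : M) : V →L[ℝ] V →L[ℝ] ℝ :=
  chartExtD α x (chartAt V x x)

lemma chartExtD_apply (α : M → V →L[ℝ] ℝ) (c : M) (y u w : V) :
    chartExtD α c y u w = fderiv ℝ (chartForm α c) y u w - fderiv ℝ (chartForm α c) y w u := rfl

lemma chartForm_sum {κ : Type*} (s : Finset κ) (α : κ → M → V →L[ℝ] ℝ) (c : M) (y : V) :
    chartForm (fun x => ∑ i ∈ s, α i x) c y = ∑ i ∈ s, chartForm (α i) c y := by
  ext v
  simp [chartForm]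

lemma formExtD_sum {κ : Type*} (s : Finset κ) {α : κ → M → V →L[ℝ] ℝ}
    (hα : ∀ i ∈ s, IsC1Form (α i)) (x : M) :
    formExtD (fun x => ∑ i ∈ s, α i x) x = ∑ i ∈ s, formExtD (α i) x := by
  have : chartForm (fun x => ∑ i ∈ s, α i x) x = fun y => ∑ i ∈ s, chartForm (α i) x y :=
    funext (chartForm_sum s α x)
  ext u w
  simp only [formExtD, chartExtD_apply, this, sum_apply]
  rw [fderiv_fun_sum fun i hi => (hα i hi x _ (mem_chart_target V x)).differentiableAt (by simp)]
  simp [Finset.sum_sub_distrib]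

variable [IsManifold 𝓘(ℂ, V) ω M]

lemma chartForm_trans (α : M → V →L[ℝ] ℝ) (c c' : M) {y : V} (hy : y ∈ (chartAt V c).target)
    (hy' : (chartAt V c).symm y ∈ (chartAt V c').source) :
    chartForm α c y = (chartForm α c' ((chartAt V c' ∘ (chartAt V c).symm) y)).comp
      (fderiv ℝ (chartAt V c' ∘ (chartAt V c).symm) y) := by
  rw [chartForm, chartDeriv_trans c c' hy hy', chartForm, Function.comp_apply,
    (chartAt V c').left_inv hy']
  rfl

/-- The exterior derivative does not depend on the chart. -/
lemma chartExtD_eq {α : M → V →L[ℝ] ℝ} (hα : IsC1Form α) (c : M) {y : V}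
    (hy : y ∈ (chartAt V c).target) (u w : V) :
    chartExtD α c y u w =
      formExtD α ((chartAt V c).symm y) (chartDeriv c y u) (chartDeriv c y w) := by
  set x := (chartAt V c).symm y with hx
  set τ := chartAt V x ∘ (chartAt V c).symm with hτ
  have hy' : (chartAt V c).symm y ∈ (chartAt V x).source := mem_chart_source V x
  have hτc : ContDiffAt ℝ ω τ y := contDiffAt_chart_trans_real c x hy hy'
  have hev : chartForm α c =ᶠ[𝓝 y] fun z => (chartForm α x (τ z)).comp (fderiv ℝ τ z) := by
    filter_upwards [((chartAt V c).symm.trans (chartAt V x)).open_source.mem_nhds ⟨hy, hy'⟩] with z hz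
    exact chartForm_trans α c x hz.1 hz.2
  have hdτ : DifferentiableAt ℝ (fderiv ℝ τ) y :=
    (hτc.fderiv_right (m := 1) le_top).differentiableAt (by simp)
  have hτd : DifferentiableAt ℝ τ y := hτc.differentiableAt (by simp)
  have hα' : DifferentiableAt ℝ (chartForm α x) (τ y) :=
    (hα x _ (mem_chart_target V x)).differentiableAt (by simp)
  have hder : ∀ u w, fderiv ℝ (chartForm α c) y u w =
      fderiv ℝ (chartForm α x) (τ y) (fderiv ℝ τ y u) (fderiv ℝ τ y w) +
        chartForm α x (τ y) (fderiv ℝ (fderiv ℝ τ) y u w) := by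
    intro u w
    have h1 : HasFDerivAt (fun z => chartForm α x (τ z)) _ y :=
      hα'.hasFDerivAt.comp y hτd.hasFDerivAt
    have h2 := h1.clm_comp hdτ.hasFDerivAt
    rw [hev.fderiv_eq, h2.fderiv]
    simp [add_comm]
  -- The non-tensorial term contains the second derivative of the transition map, whose symmetry
  -- removes it on antisymmetrization.
  have hsymm : fderiv ℝ (fderiv ℝ τ) y u w = fderiv ℝ (fderiv ℝ τ) y w u :=
    (hτc.isSymmSndFDerivAt (by simp)).eq u w
  rw [chartExtD_apply, hder, hder, hsymm, formExtD, chartExtD_apply, chartDeriv_eq_fderiv c hy]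
  change _ = fderiv ℝ (chartForm α x) (τ y) (fderiv ℝ τ y u) (fderiv ℝ τ y w) - 
    fderiv ℝ (chartForm α x) (τ y) (fderiv ℝ τ y w) (fderiv ℝ τ y u)
  ring

lemma IsC1Form.smul {f : M → ℝ} (hf : ContMDiff 𝓘(ℝ, V) 𝓘(ℝ, ℝ) ∞ f) {α : M → V →L[ℝ] ℝ}
    (hα : IsC1Form α) : IsC1Form fun x => f x • α x := by
  intro c y hy
  have h1 : ContDiffAt ℝ 1 (f ∘ (chartAt V c).symm) y := by
    have : ContMDiffAt 𝓘(ℝ, V) 𝓘(ℝ, ℝ) 1 (f ∘ (chartAt V c).symm) y :=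
      ((hf _).of_le (by simp)).comp y ((contMDiffAt_chart_symm c hy).of_le le_top)
    exact contMDiffAt_iff_contDiffAt.1 this
  exact h1.smul (hα c y hy)

end FormGeometry

/-! ### The Kähler metric in charts; the contraction of an exact form as a divergence. -/

namespace KahlerMetric

variable {V : Type u} [NormedAddCommGroup V] [NormedSpace ℂ V]
  {M : Type v} [TopologicalSpace M] [ChartedSpace V M] [IsManifold 𝓘(ℂ, V) ω M]
  (g : KahlerMetric V M)

lemma contMDiffAt_inner_chartVector (c : M) {y : V} (hy : y ∈ (chartAt V c).target) (v w : V) :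
    ContDiffAt ℝ ∞ (fun z => g.inner ((chartAt V c).symm z) (chartVector V c z v)
      (chartVector V c z w)) y := by
  have : IsManifold 𝓘(ℝ, V) 1 M := isManifold_real_of_complex 1
  have h1 := (g.contMDiff.contMDiffAt (x := (chartAt V c).symm y)).comp y
    ((contMDiffAt_chart_symm c hy).of_le (n := ω) (m := ∞) le_top)
  have h2 := ContMDiffAt.clm_bundle_apply₂ (F₁ := V) (F₂ := V) (F₃ := ℝ)
    (E₃ := fun _ : M => ℝ) h1
    (contMDiffAt_chartVector c hy v) (contMDiffAt_chartVector c hy w)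
  have h3 := (contMDiffAt_totalSpace.1 h2).2
  exact contMDiffAt_iff_contDiffAt.1 h3

lemma complexStructure_chartVector (c : M) {y : V} (hy : y ∈ (chartAt V c).target) (v : V) :
    complexStructure V _ (chartVector V c y v) = chartVector V c y (Complex.I • v) :=
  (chartDeriv_I_smul c hy v).symm

variable [FiniteDimensional ℂ V]

/-- The Gram matrix of the metric in the chart at `c`. -/
def chartGram (c : M) (y : V) :
    Matrix (Fin (Module.finrank ℝ V)) (Fin (Module.finrank ℝ V)) ℝ :=
  Matrix.of fun k l => g.inner ((chartAt V c).symm y)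
      (chartVector V c y (Module.finBasis ℝ V k))
      (chartVector V c y (Module.finBasis ℝ V l))

lemma chartDensity_eq (c : M) (y : V) : g.chartDensity c y = √(g.chartGram c y).det := rfl

lemma contDiffAt_chartGram (c : M) {y : V} (hy : y ∈ (chartAt V c).target)
    (k l : Fin (Module.finrank ℝ V)) : ContDiffAt ℝ ∞ (fun z => g.chartGram c z k l) y :=
  g.contMDiffAt_inner_chartVector c hy _ _

/-- The metric at a point as a bilinear form on the model space. -/
def bilin (x : M) : V →ₗ[ℝ] V →ₗ[ℝ] ℝ :=
  ContinuousLinearMap.toLinearMap₁₂ (g.inner x : V →L[ℝ] V →L[ℝ] ℝ)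

lemma det_gram_pos (x : M) (L : V →ₗ[ℝ] V) (hL : Function.Injective L) :
    0 < (Matrix.of fun k l => g.bilin x (L (Module.finBasis ℝ V k))
      (L (Module.finBasis ℝ V l))).det := by
  refine Matrix.PosDef.det_pos (Matrix.PosDef.of_dotProduct_mulVec_pos ?_ ?_)
  · ext k l
    simp only [Matrix.conjTranspose_apply, Matrix.of_apply, star_trivial]
    exact g.symm x _ _
  · intro a ha
    set v : V := ∑ k, a k • Module.finBasis ℝ V k
    have hv : v ≠ 0 := fun h => ha <| by
      have := (Fintype.linearIndependent_iff.1 (Module.finBasis ℝ V).linearIndependent) a h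
      exact funext this
    have h1 : 0 < g.bilin x (L v) (L v) :=
      g.pos x (L v) fun h => hv (hL (by rw [map_zero]; exact h))
    have h2 : g.bilin x (L v) (L v) = star a ⬝ᵥ (Matrix.of fun k l =>
        g.bilin x (L (Module.finBasis ℝ V k)) (L (Module.finBasis ℝ V l))).mulVec a := by
      simp only [v, map_sum, map_smul, LinearMap.sum_apply, LinearMap.smul_apply, smul_eq_mul,
        dotProduct, Matrix.mulVec, Matrix.of_apply, star_trivial, Finset.mul_sum]
      rw [Finset.sum_comm]
      refine Finset.sum_congr rfl fun k _ => Finset.sum_congr rfl fun l _ => ?_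
      ring
    rwa [← h2]

lemma det_chartGram_pos (c : M) {y : V} (hy : y ∈ (chartAt V c).target) :
    0 < (g.chartGram c y).det :=
  g.det_gram_pos ((chartAt V c).symm y) (chartDeriv c y) (chartDeriv_injective c hy)

lemma chartDensity_pos (c : M) {y : V} (hy : y ∈ (chartAt V c).target) :
    0 < g.chartDensity c y :=
  Real.sqrt_pos.2 (g.det_chartGram_pos c hy)

lemma contDiffAt_chartDensity (c : M) {y : V} (hy : y ∈ (chartAt V c).target) :
    ContDiffAt ℝ ∞ (g.chartDensity c) y :=
  (ContDiffAt.matrix_det fun k l => g.contDiffAt_chartGram c hy k l).sqrt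
    (g.det_chartGram_pos c hy).ne'

/-- The density transforms by the jacobian determinant under a change of charts. -/
lemma chartDensity_trans (c c' : M) {y : V} (hy : y ∈ (chartAt V c).target)
    (hy' : (chartAt V c).symm y ∈ (chartAt V c').source) :
    g.chartDensity c y = |(fderiv ℝ (chartAt V c' ∘ (chartAt V c).symm) y).det| *
      g.chartDensity c' (chartAt V c' ((chartAt V c).symm y)) := by
  set T := fderiv ℝ (chartAt V c' ∘ (chartAt V c).symm) y
  set b := Module.finBasis ℝ V
  have h0 : (chartAt V c').symm (chartAt V c' ((chartAt V c).symm y)) = (chartAt V c).symm y :=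
    (chartAt V c').left_inv hy'
  -- The two Gram matrices are congruent through the Jacobian, so their determinants differ by its
  -- square; the square root yields the absolute value.
  have h1 : g.chartGram c y = (LinearMap.toMatrix b b (T : V →ₗ[ℝ] V)).transpose *
      g.chartGram c' (chartAt V c' ((chartAt V c).symm y)) *
      LinearMap.toMatrix b b (T : V →ₗ[ℝ] V) := by
    set S : V →ₗ[ℝ] V →ₗ[ℝ] ℝ := (g.bilin ((chartAt V c).symm y)).compl₁₂
      (chartDeriv c' (chartAt V c' ((chartAt V c).symm y)) : V →ₗ[ℝ] V)
      (chartDeriv c' (chartAt V c' ((chartAt V c).symm y)) : V →ₗ[ℝ] V)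
    have hT := LinearMap.toMatrix₂_compl₁₂ (R := ℝ) b b b b S (T : V →ₗ[ℝ] V) (T : V →ₗ[ℝ] V)
    have e1 : LinearMap.toMatrix₂ b b (S.compl₁₂ (T : V →ₗ[ℝ] V) (T : V →ₗ[ℝ] V)) =
        g.chartGram c y := by
      ext k l
      simp only [LinearMap.toMatrix₂_apply, chartGram, Matrix.of_apply, chartVector_eq]
      rw [chartDeriv_trans c c' hy hy']
      rfl
    have e2 : LinearMap.toMatrix₂ b b S =
        g.chartGram c' (chartAt V c' ((chartAt V c).symm y)) := by
      ext k l
      simp only [LinearMap.toMatrix₂_apply, chartGram, Matrix.of_apply, chartVector_eq, S, bilin]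
      rw [h0]
      rfl
    rw [← e1, hT, e2]
  rw [chartDensity_eq, chartDensity_eq, h1, Matrix.det_mul, Matrix.det_mul, Matrix.det_transpose,
    mul_right_comm, ← sq, Real.sqrt_mul (sq_nonneg _), Real.sqrt_sq_eq_abs,
    LinearMap.det_toMatrix]

variable (V) in
/-- The matrix of the complex structure in the chosen real basis. -/
def jMatrix : Matrix (Fin (Module.finrank ℝ V)) (Fin (Module.finrank ℝ V)) ℝ :=
  LinearMap.toMatrix (Module.finBasis ℝ V) (Module.finBasis ℝ V)
    ((Complex.I • LinearMap.id : V →ₗ[ℂ] V).restrictScalars ℝ)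

lemma jMatrix_mul_self : jMatrix V * jMatrix V = -1 := by
  rw [jMatrix, ← LinearMap.toMatrix_comp]
  have : ((Complex.I • LinearMap.id : V →ₗ[ℂ] V).restrictScalars ℝ) ∘ₗ
      ((Complex.I • LinearMap.id : V →ₗ[ℂ] V).restrictScalars ℝ) = -LinearMap.id := by
    ext v
    simp [smul_smul]
  rw [this, map_neg, LinearMap.toMatrix_id]

lemma I_smul_finBasis (l : Fin (Module.finrank ℝ V)) :
    Complex.I • Module.finBasis ℝ V l = ∑ m, jMatrix V m l • Module.finBasis ℝ V m := by
  have := (Module.finBasis ℝ V).sum_repr (Complex.I • Module.finBasis ℝ V l)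
  rw [← this]
  refine Finset.sum_congr rfl fun m _ => ?_
  rw [jMatrix, LinearMap.toMatrix_apply]
  simp

/-- The matrix of the fundamental form in the chart at `c`. -/
lemma jMatrix_transpose_mul_chartGram (c : M) {y : V} (hy : y ∈ (chartAt V c).target)
    (k l : Fin (Module.finrank ℝ V)) :
    ((jMatrix V).transpose * g.chartGram c y) k l =
      g.inner ((chartAt V c).symm y)
        (complexStructure V _ (chartVector V c y (Module.finBasis ℝ V k)))
        (chartVector V c y (Module.finBasis ℝ V l)) := by
  rw [complexStructure_chartVector c hy, I_smul_finBasis]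
  simp only [chartVector_eq, map_sum, map_smul, Matrix.mul_apply, Matrix.transpose_apply, chartGram,
    Matrix.of_apply]
  change _ = g.bilin _ (∑ m, _ • _) _
  simp only [map_sum, map_smul, LinearMap.sum_apply, LinearMap.smul_apply, smul_eq_mul]
  rfl

/-- Since `J` is orthogonal and `J² = -1`, one has `-g(J v, w) = g(J v, J J w) = g(v, J w)`. -/
lemma jMatrix_transpose_mul_chartGram_skew (c : M) {y : V} (hy : y ∈ (chartAt V c).target)
    (k l : Fin (Module.finrank ℝ V)) :
    ((jMatrix V).transpose * g.chartGram c y) l k =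
      -((jMatrix V).transpose * g.chartGram c y) k l := by
  rw [jMatrix_transpose_mul_chartGram g c hy, jMatrix_transpose_mul_chartGram g c hy]
  set x := (chartAt V c).symm y
  have key : ∀ v w : TangentSpace 𝓘(ℝ, V) x, g.inner x (complexStructure V x v) w =
      -g.inner x (complexStructure V x w) v := by
    intro v w
    have aux : ∀ u : V, Complex.I • Complex.I • u = -u := fun u => by
      rw [smul_smul, Complex.I_mul_I, neg_one_smul]
    have hJJ : complexStructure V x (complexStructure V x w) = -w := aux w
    have h := g.inner_J x v (complexStructure V x w)
    rw [hJJ, map_neg] at h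
    rw [g.symm x (complexStructure V x w) v]
    linarith
  exact key _ _

/-- The contraction `½ ∑ gᵏˡ η(bₖ, J bₗ)` of a real bilinear form. -/
def realContraction (x : M) (η : V →L[ℝ] V →L[ℝ] ℝ) : ℝ :=
  1 / 2 * ∑ k, ∑ l, (g.gram x)⁻¹ k l *
    η (Module.finBasis ℝ V k) (Complex.I • Module.finBasis ℝ V l)

/-- The contraction is independent of the basis, so it may be computed in the basis carried over by
the chart differential. This differential commutes with `J`, and expanding `J bₗ` produces the
matrix `P = G⁻¹ Kᵀ`. -/
lemma realContraction_chart (c : M) {y : V} (hy : y ∈ (chartAt V c).target)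
    (η : V →L[ℝ] V →L[ℝ] ℝ) :
    g.realContraction ((chartAt V c).symm y) η = 1 / 2 * ∑ k, ∑ m,
      ((g.chartGram c y)⁻¹ * (jMatrix V).transpose) k m *
        η (chartDeriv c y (Module.finBasis ℝ V k)) (chartDeriv c y (Module.finBasis ℝ V m)) := by
  set x := (chartAt V c).symm y
  set b := Module.finBasis ℝ V
  have h := sum_inv_mul_basis_change b (g.bilin x)
    ((ContinuousLinearMap.toLinearMap₁₂ η).compl₂
      ((Complex.I • LinearMap.id : V →ₗ[ℂ] V).restrictScalars ℝ))
    (chartDeriv c y : V →ₗ[ℝ] V) (isUnit_det_chartDeriv b c hy)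
  rw [realContraction]
  congr 1
  refine Eq.trans h.symm (Finset.sum_congr rfl fun k _ => ?_)
  have h2 : ∀ l, chartDeriv c y (Complex.I • b l) = ∑ m, jMatrix V m l • chartDeriv c y (b m) := by
    intro l
    rw [I_smul_finBasis, map_sum]
    simp only [map_smul]
    rfl
  have h3 : ∀ l, (((ContinuousLinearMap.toLinearMap₁₂ η).compl₂
      ((Complex.I • LinearMap.id : V →ₗ[ℂ] V).restrictScalars ℝ))
      ((chartDeriv c y : V →ₗ[ℝ] V) (b k))) ((chartDeriv c y : V →ₗ[ℝ] V) (b l)) =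
      ∑ m, jMatrix V m l * η (chartDeriv c y (b k)) (chartDeriv c y (b m)) := by
    intro l
    change η (chartDeriv c y (b k)) (Complex.I • chartDeriv c y (b l)) = _
    rw [← chartDeriv_I_smul c hy, h2, map_sum]
    simp only [map_smul, smul_eq_mul]
  simp only [h3, Matrix.mul_apply, Matrix.transpose_apply, Finset.mul_sum, Finset.sum_mul]
  rw [Finset.sum_comm]
  refine Finset.sum_congr rfl fun m _ => Finset.sum_congr rfl fun l _ => ?_
  change (g.chartGram c y)⁻¹ k l * _ = _
  ring

/-- The vector field, in the chart at `c`, whose divergence is the contraction of `dα`. -/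
def dualField (α : M → V →L[ℝ] ℝ) (c : M) (k : Fin (Module.finrank ℝ V)) (y : V) : ℝ :=
  ∑ m, √(g.chartGram c y).det * ((g.chartGram c y)⁻¹ * (jMatrix V).transpose) k m *
    chartForm α c y (Module.finBasis ℝ V m)

lemma contDiffAt_dualField {α : M → V →L[ℝ] ℝ} (hα : IsC1Form α) (c : M) {y : V}
    (hy : y ∈ (chartAt V c).target) (k : Fin (Module.finrank ℝ V)) :
    ContDiffAt ℝ 1 (g.dualField α c k) y :=
  ContDiffAt.sum fun m _ => (ContDiffAt.sqrt_det_mul_inv_mul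
    (fun i j => (g.contDiffAt_chartGram c hy i j).of_le (by simp)) (g.det_chartGram_pos c hy) _ k m).mul
      ((hα c y hy).clm_apply contDiffAt_const)

/-- On a Kähler manifold the contraction of an exact two-form is a divergence. -/
lemma chartDensity_mul_realContraction {α : M → V →L[ℝ] ℝ} (hα : IsC1Form α) (c : M) {y : V}
    (hy : y ∈ (chartAt V c).target) :
    g.chartDensity c y *
        g.realContraction ((chartAt V c).symm y) (formExtD α ((chartAt V c).symm y)) =
      ∑ k, fderiv ℝ (g.dualField α c k) y (Module.finBasis ℝ V k) := by
  set b := Module.finBasis ℝ V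
  set P := (g.chartGram c y)⁻¹ * (jMatrix V).transpose with hP
  have hG : ∀ i j, ContDiffAt ℝ 1 (fun z => g.chartGram c z i j) y :=
    fun i j => (g.contDiffAt_chartGram c hy i j).of_le (by simp)
  have hdet := g.det_chartGram_pos c hy
  have hnear : ∀ᶠ z in 𝓝 y, z ∈ (chartAt V c).target := (chartAt V c).open_target.mem_nhds hy
  have hΩ : ∀ i j, (fun z => ((jMatrix V).transpose * g.chartGram c z) i j) =ᶠ[𝓝 y] fun z =>
      g.inner ((chartAt V c).symm z)
        (complexStructure V _ (chartVector V c z (b i))) (chartVector V c z (b j)) := fun i j =>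
    hnear.mono fun z hz => g.jMatrix_transpose_mul_chartGram c hz i j
  have hdiv := sum_fderiv_sqrt_det_mul_inv_mul hG hdet (jMatrix V) jMatrix_mul_self
    (hnear.mono fun z hz i j => g.jMatrix_transpose_mul_chartGram_skew c hz i j) b
    (fun i j k => by
      rw [(hΩ j k).fderiv_eq, (hΩ k i).fderiv_eq, (hΩ i j).fderiv_eq]
      exact g.closed c y hy (b i) (b j) (b k))
  have hPskew : ∀ k m, P m k = -P k m := inv_mul_transpose_skew hdet.ne'.isUnit jMatrix_mul_self
    fun i j => g.jMatrix_transpose_mul_chartGram_skew c hy i j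
  set A := fun k m => fderiv ℝ (chartForm α c) y (b k) (b m)
  have hterm : ∀ k m, fderiv ℝ (fun z => √(g.chartGram c z).det *
      ((g.chartGram c z)⁻¹ * (jMatrix V).transpose) k m * chartForm α c z (b m)) y (b k) =
      √(g.chartGram c y).det * P k m * A k m + fderiv ℝ (fun z => √(g.chartGram c z).det *
      ((g.chartGram c z)⁻¹ * (jMatrix V).transpose) k m) y (b k) * chartForm α c y (b m) := by
    intro k m
    have h1 : HasFDerivAt (fun z => √(g.chartGram c z).det *
      ((g.chartGram c z)⁻¹ * (jMatrix V).transpose) k m) _ y :=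
      ((ContDiffAt.sqrt_det_mul_inv_mul hG hdet (jMatrix V).transpose k m).differentiableAt
        (by simp)).hasFDerivAt
    have h2 : HasFDerivAt (fun z => chartForm α c z (b m)) _ y :=
      (((hα c y hy).differentiableAt (by simp)).hasFDerivAt).clm_apply (hasFDerivAt_const (b m) y)
    rw [(h1.fun_mul h2).fderiv]
    simp [A, hP]
    ring
  have hfd : ∀ k, fderiv ℝ (g.dualField α c k) y (b k) = ∑ m,
      (√(g.chartGram c y).det * P k m * A k m + fderiv ℝ (fun z => √(g.chartGram c z).det *
      ((g.chartGram c z)⁻¹ * (jMatrix V).transpose) k m) y (b k) * chartForm α c y (b m)) := by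
    intro k
    have : g.dualField α c k = fun z => ∑ m, √(g.chartGram c z).det *
        ((g.chartGram c z)⁻¹ * (jMatrix V).transpose) k m * chartForm α c z (b m) := rfl
    rw [this, fderiv_fun_sum fun m _ => ?_]
    · simp only [sum_apply, hterm]
    · exact ((ContDiffAt.sqrt_det_mul_inv_mul hG hdet (jMatrix V).transpose k m).mul
        ((hα c y hy).clm_apply contDiffAt_const)).differentiableAt (by simp)
  rw [Finset.sum_congr rfl fun k _ => hfd k, g.realContraction_chart c hy, g.chartDensity_eq]
  simp only [← chartExtD_eq hα c hy, chartExtD_apply, Finset.sum_add_distrib]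
  rw [Finset.sum_comm (f := fun k m => fderiv ℝ (fun z => √(g.chartGram c z).det *
      ((g.chartGram c z)⁻¹ * (jMatrix V).transpose) k m) y (b k) * chartForm α c y (b m))]
  -- The terms in which the derivative falls on `√det G · P` sum to zero by closedness; only the
  -- derivatives of `α` remain.
  simp only [← Finset.sum_mul, hdiv, zero_mul, Finset.sum_const_zero, add_zero]
  -- Against the skew `P` the antisymmetrization in `dα` merely doubles the sum, which cancels the
  -- `1 / 2` in the contraction.
  have hsk : ∑ k, ∑ m, P k m * A m k = -∑ k, ∑ m, P k m * A k m := by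
    rw [Finset.sum_comm, ← Finset.sum_neg_distrib]
    refine Finset.sum_congr rfl fun k _ => ?_
    rw [← Finset.sum_neg_distrib]
    exact Finset.sum_congr rfl fun m _ => by rw [hPskew k m]; ring
  have e1 : ∑ k, ∑ m, P k m * (A k m - A m k) = 2 * ∑ k, ∑ m, P k m * A k m := by
    simp only [mul_sub, Finset.sum_sub_distrib, hsk]
    ring
  change √(g.chartGram c y).det * (1 / 2 * ∑ k, ∑ m, P k m * (A k m - A m k)) = _
  rw [e1]
  simp only [mul_assoc, ← Finset.mul_sum]
  ring

end KahlerMetric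

/-! ### Integrals of derivatives, and compact supports in charts. -/

section Integration

variable {V : Type u} [NormedAddCommGroup V] [NormedSpace ℝ V] [FiniteDimensional ℝ V]
  [MeasurableSpace V] [BorelSpace V]

/-- The integral of a directional derivative of a compactly supported `C¹` function vanishes. -/
lemma integral_fderiv_eq_zero_of_hasCompactSupport (μ : Measure V) [μ.IsAddHaarMeasure] {F : V → ℝ}
    (hF : ContDiff ℝ 1 F) (hc : HasCompactSupport F) (v : V) : ∫ y, fderiv ℝ F y v ∂μ = 0 := by
  have h1 : Integrable (fun y => fderiv ℝ F y v) μ :=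
    ((hF.continuous_fderiv (by simp)).clm_apply continuous_const).integrable_of_hasCompactSupport
      (hc.fderiv_apply ℝ v)
  -- Integration by parts against the constant function `1`.
  have h2 := integral_mul_fderiv_eq_neg_fderiv_mul_of_integrable (μ := μ) (𝕜 := ℝ)
    (f := fun _ => (1 : ℝ)) (g := F) (v := v) (by simp) (by simpa using h1)
    (by simpa using hF.continuous.integrable_of_hasCompactSupport hc)
    (fun _ _ => differentiableAt_const _) (fun _ _ => (hF.differentiable (by simp)).differentiableAt)
  simpa using h2

end Integration

section Charts

variable {V : Type*} [TopologicalSpace V] {M : Type*} [TopologicalSpace M] [ChartedSpace V M]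

lemma continuousOn_comp_chart_symm (c : M) {f : M → ℝ} (hf : Continuous f) :
    ContinuousOn (fun y => f ((chartAt V c).symm y)) (chartAt V c).target :=
  hf.comp_continuousOn (chartAt V c).continuousOn_symm

lemma isCompact_image_chart [CompactSpace M] (c : M) {K : Set M} (hK : IsClosed K) (hKc : K ⊆ (chartAt V c).source) :
    IsCompact (chartAt V c '' K) :=
  hK.isCompact.image_of_continuousOn ((chartAt V c).continuousOn.mono hKc)

end Charts

/-! ### Integration on a compact Kähler manifold and Stokes' theorem. -/

namespace KahlerMetric

variable {V : Type u} [NormedAddCommGroup V] [NormedSpace ℂ V]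
  {M : Type v} [TopologicalSpace M] [ChartedSpace V M] [IsManifold 𝓘(ℂ, V) ω M]
  [FiniteDimensional ℂ V] (g : KahlerMetric V M)

lemma continuousOn_chartDensity (c : M) :
    ContinuousOn (g.chartDensity c) (chartAt V c).target := fun _ hy =>
  (g.contDiffAt_chartDensity c hy).continuousAt.continuousWithinAt

/-- `formExtD` uses a different chart at each point, so continuity is not visible from its
definition. In one fixed chart, however, the contraction is the divergence of a `C¹` field divided
by the positive density. -/
lemma continuous_realContraction_formExtD {α : M → V →L[ℝ] ℝ} (hα : IsC1Form α) :
    Continuous fun x => g.realContraction x (formExtD α x) := by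
  rw [continuous_iff_continuousAt]
  intro x
  have h1 : ContinuousAt (fun y => (∑ k, fderiv ℝ (g.dualField α x k) y (Module.finBasis ℝ V k)) /
      g.chartDensity x y) (chartAt V x x) := by
    refine ContinuousAt.div (tendsto_finsetSum _ fun k _ => ?_)
      (g.contDiffAt_chartDensity x (mem_chart_target V x)).continuousAt
      (g.chartDensity_pos x (mem_chart_target V x)).ne'
    exact ((((g.contDiffAt_dualField hα x (mem_chart_target V x) k).fderiv_right (m := 0)
      (by simp)).continuousAt).clm_apply continuousAt_const)
  have h2 := ContinuousAt.comp (f := chartAt V x) (x := x) h1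
    ((chartAt V x).continuousAt (mem_chart_source V x))
  refine h2.congr ?_
  filter_upwards [(chartAt V x).open_source.mem_nhds (mem_chart_source V x)] with p hp
  have hp' := (chartAt V x).map_source hp
  have h3 := g.chartDensity_mul_realContraction hα x hp'
  rw [(chartAt V x).left_inv hp] at h3
  simp only [Function.comp_apply]
  rw [← h3, mul_div_cancel_left₀ _ (g.chartDensity_pos x hp').ne']

lemma realContraction_formExtD_eq_zero {α : M → V →L[ℝ] ℝ} {K : Set M} (hK : IsClosed K)
    (hαK : ∀ x ∉ K, α x = 0) {x : M} (hx : x ∉ K) : g.realContraction x (formExtD α x) = 0 := by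
  have h1 : chartForm α x =ᶠ[𝓝 (chartAt V x x)] fun _ => 0 := by
    have h2 : Tendsto (chartAt V x).symm (𝓝 (chartAt V x x)) (𝓝 x) := by
      have := (chartAt V x).continuousAt_symm (mem_chart_target V x)
      rwa [ContinuousAt, (chartAt V x).left_inv (mem_chart_source V x)] at this
    filter_upwards [h2 (hK.isOpen_compl.mem_nhds hx)] with y hy
    simp [chartForm, hαK _ hy]
  have h2 : formExtD α x = 0 := by
    ext u w
    rw [formExtD, chartExtD_apply, h1.fderiv_eq]
    simp
  simp [realContraction, h2]

section Partition

variable [T2Space M] [CompactSpace M]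

variable (V M) in
/-- The partition of unity through which integrals are computed. -/
def chartPartition : SmoothPartitionOfUnity M 𝓘(ℝ, V) M univ :=
  Classical.choose
    (SmoothPartitionOfUnity.exists_isSubordinate_chartAt_source (M := M) 𝓘(ℝ, V))

lemma tsupport_chartPartition_subset (c : M) :
    tsupport (chartPartition V M c) ⊆ (chartAt V c).source :=
  Classical.choose_spec
    (SmoothPartitionOfUnity.exists_isSubordinate_chartAt_source (M := M) 𝓘(ℝ, V)) c

variable (V M) in
lemma finite_chartPartition : {c : M | (Function.support (chartPartition V M c)).Nonempty}.Finite :=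
  (chartPartition V M).locallyFinite.finite_nonempty_of_compact

variable (V M) in
/-- The finitely many charts used by the partition of unity. -/
def partitionIndex : Finset M := (finite_chartPartition V M).toFinset

lemma chartPartition_eq_zero {c : M} (hc : c ∉ partitionIndex V M) (x : M) :
    chartPartition V M c x = 0 := by
  by_contra h
  exact hc ((finite_chartPartition V M).mem_toFinset.2 ⟨x, h⟩)

lemma sum_chartPartition (x : M) : ∑ c ∈ partitionIndex V M, chartPartition V M c x = 1 := by
  rw [← (chartPartition V M).sum_eq_one (mem_univ x)]
  refine (finsum_eq_sum_of_support_subset _ fun c hc => ?_).symm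
  by_contra h
  exact hc (chartPartition_eq_zero h x)

lemma continuous_chartPartition (c : M) : Continuous (chartPartition V M c) :=
  (chartPartition V M c).contMDiff.continuous

lemma tsupport_chartPartition_mul (c : M) (f : M → ℝ) :
    tsupport (fun x => chartPartition V M c x * f x) ⊆ (chartAt V c).source :=
  (tsupport_mul_subset_left (f := chartPartition V M c) (g := f)).trans
    (tsupport_chartPartition_subset c)

lemma chartPartition_mul_nonneg {f : M → ℝ} (hf : ∀ x, 0 ≤ f x) (c : M) {y : V}
    (hy : y ∈ (chartAt V c).target) : 0 ≤ chartPartition V M c ((chartAt V c).symm y) *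
      f ((chartAt V c).symm y) * g.chartDensity c y :=
  mul_nonneg (mul_nonneg ((chartPartition V M).nonneg c _) (hf _)) (g.chartDensity_pos c hy).le

end Partition

variable [MeasurableSpace V] [BorelSpace V]

/-- The integral of a function over the domain of the chart at `c`. -/
def chartIntegral (c : M) (f : M → ℝ) : ℝ :=
  ∫ y in (chartAt V c).target, f ((chartAt V c).symm y) * g.chartDensity c y
    ∂(Module.finBasis ℝ V).addHaar

section Compact

variable [CompactSpace M]

/-- By compactness of `M` the support has compact image in the chart; the integrand is continuous
there and zero elsewhere. -/
lemma integrableOn_chart (c : M) {f : M → ℝ} (hf : Continuous f)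
    (hs : tsupport f ⊆ (chartAt V c).source) :
    IntegrableOn (fun y => f ((chartAt V c).symm y) * g.chartDensity c y) (chartAt V c).target
      (Module.finBasis ℝ V).addHaar := by
  have hsub : chartAt V c '' tsupport f ⊆ (chartAt V c).target := by
    rintro _ ⟨x, hx, rfl⟩
    exact (chartAt V c).map_source (hs hx)
  refine IntegrableOn.of_forall_sdiff_eq_zero (s := chartAt V c '' tsupport f) ?_
    (chartAt V c).open_target.measurableSet ?_
  · exact (((continuousOn_comp_chart_symm c hf).mul (g.continuousOn_chartDensity c)).mono
      hsub).integrableOn_compact (isCompact_image_chart c (isClosed_tsupport f) hs)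
  · rintro y ⟨hy, hy'⟩
    have : (chartAt V c).symm y ∉ tsupport f := fun h =>
      hy' ⟨_, h, (chartAt V c).right_inv hy⟩
    rw [image_eq_zero_of_notMem_tsupport this, zero_mul]

lemma chartIntegral_sum {κ : Type*} (s : Finset κ) (c : M) {f : κ → M → ℝ}
    (hf : ∀ i ∈ s, Continuous (f i)) (hs : ∀ i ∈ s, tsupport (f i) ⊆ (chartAt V c).source) :
    g.chartIntegral c (fun x => ∑ i ∈ s, f i x) = ∑ i ∈ s, g.chartIntegral c (f i) := by
  simp only [chartIntegral, Finset.sum_mul]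
  exact integral_finsetSum s fun i hi => g.integrableOn_chart c (hf i hi) (hs i hi)

/-- **Stokes' theorem** for a one-form supported in a chart. -/
lemma chartIntegral_realContraction_formExtD {α : M → V →L[ℝ] ℝ} (hα : IsC1Form α) (c : M)
    {K : Set M} (hK : IsClosed K) (hKc : K ⊆ (chartAt V c).source) (hαK : ∀ x ∉ K, α x = 0) :
    g.chartIntegral c (fun x => g.realContraction x (formExtD α x)) = 0 := by
  set U := (chartAt V c).target
  set K' := chartAt V c '' K
  have hK' : IsCompact K' := isCompact_image_chart c hK hKc
  have hK'U : K' ⊆ U := by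
    rintro _ ⟨x, hx, rfl⟩
    exact (chartAt V c).map_source (hKc hx)
  -- Extension by zero: near the compact image of `K` this is the dual field, and off that image it
  -- is locally zero, so it is `C¹` on the whole space with compact support.
  set Z : Fin (Module.finrank ℝ V) → V → ℝ := fun k => U.indicator (g.dualField α c k)
  have hZ0 : ∀ k y, y ∉ K' → Z k y = 0 := by
    intro k y hy
    by_cases hyU : y ∈ U
    · have : α ((chartAt V c).symm y) = 0 := hαK _ fun h => hy ⟨_, h, (chartAt V c).right_inv hyU⟩
      simp [Z, hyU, dualField, chartForm, this]
    · simp [Z, hyU]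
  have hZU : ∀ k, ∀ y ∈ U, Z k =ᶠ[𝓝 y] g.dualField α c k := fun k y hy => by
    filter_upwards [(chartAt V c).open_target.mem_nhds hy] with z hz
    exact indicator_of_mem hz _
  have hZc : ∀ k y, y ∉ K' → Z k =ᶠ[𝓝 y] fun _ => 0 := fun k y hy => by
    filter_upwards [hK'.isClosed.isOpen_compl.mem_nhds hy] with z hz
    exact hZ0 k z hz
  have hZd : ∀ k, ContDiff ℝ 1 (Z k) := fun k => contDiff_iff_contDiffAt.2 fun y => by
    by_cases hy : y ∈ K'
    · exact (g.contDiffAt_dualField hα c (hK'U hy) k).congr_of_eventuallyEq (hZU k y (hK'U hy))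
    · exact contDiffAt_const.congr_of_eventuallyEq (hZc k y hy)
  have hZs : ∀ k, HasCompactSupport (Z k) := fun k => HasCompactSupport.intro hK' (hZ0 k)
  have h1 : g.chartIntegral c (fun x => g.realContraction x (formExtD α x)) =
      ∫ y in U, ∑ k, fderiv ℝ (Z k) y (Module.finBasis ℝ V k) ∂(Module.finBasis ℝ V).addHaar := by
    refine setIntegral_congr_fun (chartAt V c).open_target.measurableSet fun y hy => ?_
    simp only
    rw [mul_comm, g.chartDensity_mul_realContraction hα c hy]
    exact Finset.sum_congr rfl fun k _ => by rw [(hZU k y hy).fderiv_eq]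
  have h2 : ∀ y ∉ U, ∑ k, fderiv ℝ (Z k) y (Module.finBasis ℝ V k) = 0 := fun y hy =>
    Finset.sum_eq_zero fun k _ => by
      rw [(hZc k y fun h => hy (hK'U h)).fderiv_eq]
      simp
  rw [h1, setIntegral_eq_integral_of_forall_compl_eq_zero h2, MeasureTheory.integral_finsetSum]
  · exact Finset.sum_eq_zero fun k _ =>
      integral_fderiv_eq_zero_of_hasCompactSupport _ (hZd k) (hZs k) _
  · exact fun k _ => (((hZd k).continuous_fderiv (by simp)).clm_apply
      continuous_const).integrable_of_hasCompactSupport ((hZs k).fderiv_apply ℝ _)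

end Compact

lemma chartIntegral_const_mul (c : M) (a : ℝ) (f : M → ℝ) :
    g.chartIntegral c (fun x => a * f x) = a * g.chartIntegral c f := by
  simp only [chartIntegral, mul_assoc]
  exact integral_const_mul a _

lemma chartIntegral_eq_setIntegral (c : M) {f : M → ℝ} {S : Set V} (hS : S ⊆ (chartAt V c).target)
    (hf : ∀ y ∈ (chartAt V c).target, y ∉ S → f ((chartAt V c).symm y) = 0) :
    g.chartIntegral c f = ∫ y in S, f ((chartAt V c).symm y) * g.chartDensity c y
      ∂(Module.finBasis ℝ V).addHaar :=
  setIntegral_eq_of_subset_of_forall_sdiff_eq_zero (chartAt V c).open_target.measurableSet hS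
    fun y hy => by rw [hf y hy.1 hy.2, zero_mul]

/-- The integral of a function supported in two charts does not depend on the chart. -/
lemma chartIntegral_eq_chartIntegral (c c' : M) {f : M → ℝ}
    (hf : ∀ x, x ∉ (chartAt V c).source → f x = 0) (hf' : ∀ x, x ∉ (chartAt V c').source → f x = 0) :
    g.chartIntegral c f = g.chartIntegral c' f := by
  set T := (chartAt V c).symm.trans (chartAt V c') with hT
  have hsrc : ∀ y, y ∈ T.source ↔ y ∈ (chartAt V c).target ∧
      (chartAt V c).symm y ∈ (chartAt V c').source := fun y => Iff.rfl
  have htgt : ∀ z, z ∈ T.target ↔ z ∈ (chartAt V c').target ∧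
      (chartAt V c').symm z ∈ (chartAt V c).source := fun y => Iff.rfl
  have h1 := g.chartIntegral_eq_setIntegral c (f := f) (S := T.source) (fun y hy => hy.1)
    fun y hy hy' => hf' _ fun h => hy' ⟨hy, h⟩
  have h2 := g.chartIntegral_eq_setIntegral c' (f := f) (S := T.target) (fun y hy => hy.1)
    fun y hy hy' => hf _ fun h => hy' ⟨hy, h⟩
  -- Change of variables along the transition map; its Jacobian is absorbed by `chartDensity_trans`.
  have h3 := integral_image_eq_integral_abs_det_fderiv_smul (Module.finBasis ℝ V).addHaar
    T.open_source.measurableSet (f := chartAt V c' ∘ (chartAt V c).symm)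
    (f' := fun y => fderiv ℝ (chartAt V c' ∘ (chartAt V c).symm) y)
    (fun y hy => ((contDiffAt_chart_trans_real c c' hy.1 hy.2).differentiableAt
      (by simp)).hasFDerivAt.hasFDerivWithinAt) T.injOn
    (fun z => f ((chartAt V c').symm z) * g.chartDensity c' z)
  have h4 : (chartAt V c' ∘ (chartAt V c).symm) '' T.source = T.target := T.image_source_eq_target
  rw [h1, h2, ← h4, h3]
  refine setIntegral_congr_fun T.open_source.measurableSet fun y hy => ?_
  simp only [Function.comp_apply, smul_eq_mul]
  rw [(chartAt V c').left_inv (show (chartAt V c).symm y ∈ _ from hy.2), g.chartDensity_trans c c' hy.1 hy.2]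
  ring

variable [T2Space M] [CompactSpace M]

/-- `chartPartition` is definitionally the partition chosen inside `integral`, and compactness
leaves only finitely many nonzero members. -/
lemma integral_eq_sum (f : M → ℝ) : g.integral f =
    ∑ c ∈ partitionIndex V M, g.chartIntegral c (fun x => chartPartition V M c x * f x) := by
  refine finsum_eq_sum_of_support_subset
    (fun c => g.chartIntegral c (fun x => chartPartition V M c x * f x)) fun c hc => ?_
  by_contra h
  refine hc ?_
  simp only [chartIntegral]
  rw [setIntegral_congr_fun (g := fun _ => (0 : ℝ)) (chartAt V c).open_target.measurableSet]
  · simp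
  · intro y _
    simp [chartPartition_eq_zero h]

lemma integral_sum {κ : Type*} (s : Finset κ) {f : κ → M → ℝ} (hf : ∀ i ∈ s, Continuous (f i)) :
    g.integral (fun x => ∑ i ∈ s, f i x) = ∑ i ∈ s, g.integral (f i) := by
  simp only [integral_eq_sum, Finset.mul_sum]
  rw [Finset.sum_comm]
  exact Finset.sum_congr rfl fun c _ => g.chartIntegral_sum s c
    (fun i hi => (continuous_chartPartition c).mul (hf i hi))
    fun i _ => tsupport_chartPartition_mul c (f i)

lemma integral_add {f₁ f₂ : M → ℝ} (h₁ : Continuous f₁) (h₂ : Continuous f₂) :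
    g.integral (fun x => f₁ x + f₂ x) = g.integral f₁ + g.integral f₂ := by
  have h := g.integral_sum Finset.univ (f := ![f₁, f₂]) (fun i _ => by fin_cases i <;> assumption)
  simpa using h

lemma integral_const_mul (a : ℝ) (f : M → ℝ) :
    g.integral (fun x => a * f x) = a * g.integral f := by
  simp only [integral_eq_sum, Finset.mul_sum]
  refine Finset.sum_congr rfl fun c _ => ?_
  rw [← chartIntegral_const_mul]
  congr 1
  funext x
  ring

lemma integral_const (a : ℝ) : g.integral (fun _ => a) = a * g.vol := by
  rw [vol, ← g.integral_const_mul]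
  simp

/-- The integral of a function supported in one chart is computed in that chart. -/
lemma integral_eq_chartIntegral (c : M) {f : M → ℝ} (hf : Continuous f)
    (hs : tsupport f ⊆ (chartAt V c).source) : g.integral f = g.chartIntegral c f := by
  have h0 : ∀ x, x ∉ (chartAt V c).source → f x = 0 := fun x hx =>
    image_eq_zero_of_notMem_tsupport fun h => hx (hs h)
  -- Each piece is supported in both charts, so all pieces can be moved to the chart at `c`, where
  -- the partition sums to one.
  have h1 : ∀ c', g.chartIntegral c' (fun x => chartPartition V M c' x * f x) =
      g.chartIntegral c (fun x => chartPartition V M c' x * f x) := fun c' =>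
    g.chartIntegral_eq_chartIntegral c' c
      (fun x hx => image_eq_zero_of_notMem_tsupport (f := fun x => chartPartition V M c' x * f x)
        fun h => hx (tsupport_chartPartition_mul c' f h))
      (fun x hx => by rw [h0 x hx, mul_zero])
  rw [integral_eq_sum, Finset.sum_congr rfl fun c' _ => h1 c', ← chartIntegral_sum]
  · simp only [← Finset.sum_mul, sum_chartPartition, one_mul]
  · exact fun c' _ => (continuous_chartPartition c').mul hf
  · exact fun c' _ => (tsupport_mul_subset_right (f := chartPartition V M c') (g := f)).trans hs

lemma chartIntegral_nonneg {f : M → ℝ} (hf : ∀ x, 0 ≤ f x) (c : M) :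
    0 ≤ g.chartIntegral c (fun x => chartPartition V M c x * f x) :=
  setIntegral_nonneg (chartAt V c).open_target.measurableSet fun _ hy =>
    g.chartPartition_mul_nonneg hf c hy

lemma integral_nonneg {f : M → ℝ} (hf : ∀ x, 0 ≤ f x) : 0 ≤ g.integral f := by
  rw [integral_eq_sum]
  exact Finset.sum_nonneg fun c _ => g.chartIntegral_nonneg hf c

/-- Each chart contribution is nonnegative, hence zero. Its continuous integrand vanishes almost
everywhere on an open set, hence everywhere there; dividing by the positive density and summing the
partition recovers `f`. This converts equality of degrees into vanishing Higgs fields. -/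
lemma eq_zero_of_integral_eq_zero {f : M → ℝ} (hc : Continuous f) (hf : ∀ x, 0 ≤ f x)
    (h : g.integral f = 0) (x : M) : f x = 0 := by
  rw [integral_eq_sum, Finset.sum_eq_zero_iff_of_nonneg fun c _ => g.chartIntegral_nonneg hf c] at h
  have key : ∀ c ∈ partitionIndex V M, chartPartition V M c x * f x = 0 := by
    intro c hcI
    by_cases hx : x ∈ (chartAt V c).source
    · have hcont : Continuous fun x => chartPartition V M c x * f x :=
        (continuous_chartPartition c).mul hc
      have h1 := (setIntegral_eq_zero_iff_of_nonneg_ae (μ := (Module.finBasis ℝ V).addHaar)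
        (ae_restrict_of_forall_mem (chartAt V c).open_target.measurableSet fun y hy =>
          g.chartPartition_mul_nonneg hf c hy)
        (g.integrableOn_chart c hcont (tsupport_chartPartition_mul c f))).1 (h c hcI)
      have h2 := Measure.eqOn_open_of_ae_eq h1 (chartAt V c).open_target
        ((continuousOn_comp_chart_symm c hcont).mul (g.continuousOn_chartDensity c))
        continuousOn_const ((chartAt V c).map_source hx)
      have h3 := (mul_eq_zero.1 h2).resolve_right
        (g.chartDensity_pos c ((chartAt V c).map_source hx)).ne'
      simpa [(chartAt V c).left_inv hx] using h3
    · rw [image_eq_zero_of_notMem_tsupport fun h => hx (tsupport_chartPartition_subset c h), zero_mul]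
  have := Finset.sum_eq_zero key
  rwa [← Finset.sum_mul, sum_chartPartition, one_mul] at this

lemma vol_pos [Nonempty M] : 0 < g.vol := by
  refine lt_of_le_of_ne (g.integral_nonneg fun _ => zero_le_one) fun h => ?_
  exact one_ne_zero (g.eq_zero_of_integral_eq_zero continuous_const (fun _ => zero_le_one) h.symm
    (Classical.arbitrary M))

/-- **Stokes' theorem**: on a compact Kähler manifold the contraction of an exact two-form with the
Kähler form integrates to zero. -/
theorem integral_realContraction_formExtD {α : M → V →L[ℝ] ℝ} (hα : IsC1Form α) :
    g.integral (fun x => g.realContraction x (formExtD α x)) = 0 := by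
  -- The form itself is cut, not its derivative: `dα = ∑ d (ρ_c α)`, and each summand is the
  -- derivative of a form supported in one chart.
  set β : M → M → V →L[ℝ] ℝ := fun c x => chartPartition V M c x • α x
  have hβ : ∀ c, IsC1Form (β c) := fun c => hα.smul (chartPartition V M c).contMDiff
  have hsum : α = fun x => ∑ c ∈ partitionIndex V M, β c x := by
    funext x
    simp only [β, ← Finset.sum_smul, sum_chartPartition, one_smul]
  have h1 : ∀ x, g.realContraction x (formExtD α x) =
      ∑ c ∈ partitionIndex V M, g.realContraction x (formExtD (β c) x) := by
    intro x
    nth_rewrite 1 [hsum]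
    rw [formExtD_sum _ fun c _ => hβ c]
    simp only [realContraction, sum_apply, Finset.mul_sum]
    rw [Finset.sum_comm (s := partitionIndex V M)]
    refine Finset.sum_congr rfl fun k _ => ?_
    rw [Finset.sum_comm (s := partitionIndex V M)]
  have hK : ∀ c, ∀ x ∉ tsupport (chartPartition V M c), β c x = 0 := fun c x hx => by
    simp [β, image_eq_zero_of_notMem_tsupport hx]
  simp only [h1]
  rw [integral_sum _ _ fun c _ => g.continuous_realContraction_formExtD (hβ c)]
  refine Finset.sum_eq_zero fun c _ => ?_
  rw [g.integral_eq_chartIntegral c (g.continuous_realContraction_formExtD (hβ c))]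
  · exact g.chartIntegral_realContraction_formExtD (hβ c) c (isClosed_tsupport _)
      (tsupport_chartPartition_subset c) (hK c)
  · refine (closure_minimal (fun x hx => ?_) (isClosed_tsupport (chartPartition V M c))).trans
      (tsupport_chartPartition_subset c)
    by_contra h
    exact hx (g.realContraction_formExtD_eq_zero (isClosed_tsupport _) (hK c) h)

end KahlerMetric

/-! ### Local frames and differentiable sections. -/

namespace HermitianBundle

variable {V : Type u} [NormedAddCommGroup V] [NormedSpace ℂ V]
  {M : Type v} [TopologicalSpace M] [ChartedSpace V M] (E : HermitianBundle.{u, v, w} V M)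

/-- The base set of the preferred trivialization at `x`. -/
def baseSet (x : M) : Set M := (trivializationAt E.F E.Fiber x).baseSet

lemma mem_baseSet (x : M) : x ∈ E.baseSet x := FiberBundle.mem_baseSet_trivializationAt' x

lemma baseSet_mem_nhds (x : M) : E.baseSet x ∈ 𝓝 x :=
  (trivializationAt E.F E.Fiber x).open_baseSet.mem_nhds (E.mem_baseSet x)

/-- The `i`-th coefficient at `y` in the preferred trivialization at `x`. -/
def coef (x : M) (i : Fin E.rank) (y : M) : E.Fiber y →ₗ[ℂ] ℂ :=
  (Module.finBasis ℂ E.F).coord i ∘ₗ (trivializationAt E.F E.Fiber x).linearMapAt ℂ y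

/-- The basis of the fibre at `y` given by the preferred trivialization at `x`. -/
def frameBasis {x y : M} (hy : y ∈ E.baseSet x) : Module.Basis (Fin E.rank) ℂ (E.Fiber y) :=
  (Module.finBasis ℂ E.F).map ((trivializationAt E.F E.Fiber x).linearEquivAt ℂ y hy).symm

/-- The local frame of the preferred trivialization at `x`. -/
def frame (x : M) (i : Fin E.rank) : ∀ y, E.Fiber y :=
  E.ext (E.frameBasis (E.mem_baseSet x) i)

variable {E}

lemma frameBasis_repr {x y : M} (hy : y ∈ E.baseSet x) (e : E.Fiber y) (i : Fin E.rank) :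
    (E.frameBasis hy).repr e i = E.coef x i y e := by
  simp only [frameBasis, coef, LinearMap.comp_apply, Module.Basis.map_repr,
    LinearEquiv.symm_symm]
  rw [Trivialization.linearMapAt_def_of_mem _ hy]
  rfl

lemma frame_eq {x y : M} (hy : y ∈ E.baseSet x) (i : Fin E.rank) :
    E.frame x i y = E.frameBasis hy i := by
  have h : E.frame x i y = (trivializationAt E.F E.Fiber x).symm y
    ((trivializationAt E.F E.Fiber x).linearEquivAt ℂ x (E.mem_baseSet x)
      (E.frameBasis (E.mem_baseSet x) i)) := rfl
  have h2 : (trivializationAt E.F E.Fiber x).linearEquivAt ℂ x (E.mem_baseSet x)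
      (E.frameBasis (E.mem_baseSet x) i) = Module.finBasis ℂ E.F i :=
    LinearEquiv.apply_symm_apply _ _
  rw [h, h2]
  rfl

lemma smoothAt_frame (x : M) (i : Fin E.rank) : E.SmoothAt (E.frame x i) x := smoothAt_ext _

lemma sum_coef_smul_frame {x y : M} (hy : y ∈ E.baseSet x) (e : E.Fiber y) :
    ∑ i, E.coef x i y e • E.frame x i y = e := by
  simp only [← frameBasis_repr hy, frame_eq hy, Module.Basis.sum_repr]

lemma trace_eq_sum_coef {x y : M} (hy : y ∈ E.baseSet x) (T : E.Fiber y →ₗ[ℂ] E.Fiber y) :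
    LinearMap.trace ℂ (E.Fiber y) T = ∑ i, E.coef x i y (T (E.frame x i y)) := by
  rw [LinearMap.trace_eq_matrix_trace ℂ (E.frameBasis hy), Matrix.trace]
  refine Finset.sum_congr rfl fun i _ => ?_
  rw [Matrix.diag_apply, LinearMap.toMatrix_apply, frameBasis_repr, frame_eq hy]

lemma coef_frame (x : M) (i j : Fin E.rank) :
    E.coef x j x (E.frame x i x) = if i = j then 1 else 0 := by
  rw [frame_eq (E.mem_baseSet x), ← frameBasis_repr (E.mem_baseSet x), Module.Basis.repr_self,
    Finsupp.single_apply]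

lemma diffAt_iff {σ : ∀ y, E.Fiber y} {x : M} : E.DiffAt σ x ↔
    MDifferentiableAt 𝓘(ℝ, V) 𝓘(ℝ, E.F)
      (fun y => (trivializationAt E.F E.Fiber x).linearMapAt ℂ y (σ y)) x := by
  refine (mdifferentiableAt_section 𝓘(ℝ, V) σ).trans ?_
  refine Filter.EventuallyEq.mdifferentiableAt_iff ?_
  filter_upwards [E.baseSet_mem_nhds x] with y hy
  rw [Trivialization.coe_linearMapAt_of_mem _ hy]

variable (E) in
/-- The real linear functional underlying a coefficient on the typical fibre. -/
def coordCLM (i : Fin E.rank) : E.F →L[ℝ] ℂ :=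
  (LinearMap.toContinuousLinearMap ((Module.finBasis ℂ E.F).coord i)).restrictScalars ℝ

lemma DiffAt.coef {σ : ∀ y, E.Fiber y} {x : M} (hσ : E.DiffAt σ x) (i : Fin E.rank) :
    MDifferentiableAt 𝓘(ℝ, V) 𝓘(ℝ, ℂ) (fun y => E.coef x i y (σ y)) x :=
  MDifferentiableAt.comp (g := E.coordCLM i) x (E.coordCLM i).mdifferentiableAt (diffAt_iff.1 hσ)

lemma DiffAt.complex_smul {σ : ∀ y, E.Fiber y} {x : M} (hσ : E.DiffAt σ x) {f : M → ℂ}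
    (hf : MDifferentiableAt 𝓘(ℝ, V) 𝓘(ℝ, ℂ) f x) : E.DiffAt (fun y => f y • σ y) x := by
  rw [diffAt_iff] at hσ ⊢
  simp only [map_smul]
  have h : DifferentiableAt ℝ (fun p : ℂ × E.F => p.1 • p.2)
      (f x, (trivializationAt E.F E.Fiber x).linearMapAt ℂ x (σ x)) :=
    differentiableAt_fst.smul differentiableAt_snd
  exact MDifferentiableAt.comp (g := fun p : ℂ × E.F => p.1 • p.2)
    (f := fun y => (f y, (trivializationAt E.F E.Fiber x).linearMapAt ℂ y (σ y))) x
    h.mdifferentiableAt (hf.prodMk_space hσ)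

lemma DiffAt.const_smul {σ : ∀ y, E.Fiber y} {x : M} (hσ : E.DiffAt σ x) (c : ℂ) :
    E.DiffAt (fun y => c • σ y) x :=
  hσ.complex_smul mdifferentiableAt_const

lemma DiffAt.sum {κ : Type*} {s : Finset κ} {σ : κ → ∀ y, E.Fiber y} {x : M}
    (hσ : ∀ i ∈ s, E.DiffAt (σ i) x) : E.DiffAt (fun y => ∑ i ∈ s, σ i y) x :=
  MDifferentiableAt.sum_section hσ

lemma DiffAt.sub {σ τ : ∀ y, E.Fiber y} {x : M} (hσ : E.DiffAt σ x) (hτ : E.DiffAt τ x) :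
    E.DiffAt (fun y => σ y - τ y) x := by
  have := hσ.add (hτ.const_smul (-1))
  simpa only [neg_one_smul, ← sub_eq_add_neg] using this

end HermitianBundle

/-! ### Derivatives in the preferred chart, complex Leibniz rule, commuting coordinate fields. -/

section ChartDerivative

variable {V : Type u} [NormedAddCommGroup V] [NormedSpace ℝ V]
  {M : Type v} [TopologicalSpace M] [ChartedSpace V M]
  {W : Type w} [NormedAddCommGroup W] [NormedSpace ℝ W]

/-- The derivative at `x` of a function, in the preferred chart at `x`. -/
def fderivChart (f : M → W) (x : M) : V →L[ℝ] W :=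
  fderiv ℝ (f ∘ (chartAt V x).symm) (chartAt V x x)

lemma mfderiv_eq_fderivChart {f : M → W} {x : M} (hf : MDifferentiableAt 𝓘(ℝ, V) 𝓘(ℝ, W) f x) :
    mfderiv 𝓘(ℝ, V) 𝓘(ℝ, W) f x = fderivChart (V := V) f x := by
  rw [hf.mfderiv]
  simp [writtenInExtChartAt, fderivChart, mfld_simps]
  rfl

lemma MDifferentiableAt.comp_chart_symm {f : M → W} {x : M}
    (hf : MDifferentiableAt 𝓘(ℝ, V) 𝓘(ℝ, W) f x) :
    DifferentiableAt ℝ (f ∘ (chartAt V x).symm) (chartAt V x x) := by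
  have h := hf.2
  simp only [DifferentiableWithinAtProp, mfld_simps] at h
  exact differentiableWithinAt_univ.1 h

lemma lieBracketWithin_univ_eq_zero {X Y : V → V} {y v w : V} (hX : X =ᶠ[𝓝 y] fun _ => v)
    (hY : Y =ᶠ[𝓝 y] fun _ => w) : VectorField.lieBracketWithin ℝ X Y univ y = 0 := by
  simp only [VectorField.lieBracketWithin, fderivWithin_univ]
  rw [hX.fderiv_eq, hY.fderiv_eq]
  simp

end ChartDerivative

namespace UnitaryConnection

variable {V : Type u} [NormedAddCommGroup V] [NormedSpace ℂ V]
  {M : Type v} [TopologicalSpace M] [ChartedSpace V M] [IsManifold 𝓘(ℂ, V) ω M]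
  {E : HermitianBundle.{u, v, w} V M} (D : UnitaryConnection E)

lemma toFun_real_smul {σ : ∀ y, E.Fiber y} {x : M} (hσ : E.DiffAt σ x) {f : M → ℝ}
    (hf : MDifferentiableAt 𝓘(ℝ, V) 𝓘(ℝ, ℝ) f x) (v : V) :
    D.toFun (fun y => f y • σ y) x v =
      f x • D.toFun σ x v + (fderivChart f x v) • σ x := by
  have h := D.isCovariantDerivativeOnUniv.leibniz hσ hf
  have h2 := congrArg (fun L => L v) h
  refine Eq.trans h2 ?_
  have h3 : mvfderiv 𝓘(ℝ, V) f x v = fderivChart f x v := by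
    rw [← mfderiv_eq_fderivChart hf]; rfl
  rw [← h3]
  rfl

/-- A covariant derivative carries only the real Leibniz rule. It is applied to `Re f` on `σ` and
`Im f` on `i σ`, and complex linearity moves `i` through the derivative. -/
lemma toFun_complex_smul {σ : ∀ y, E.Fiber y} {x : M} (hσ : E.DiffAt σ x) {f : M → ℂ}
    (hf : MDifferentiableAt 𝓘(ℝ, V) 𝓘(ℝ, ℂ) f x) (v : V) :
    D.toFun (fun y => f y • σ y) x v =
      f x • D.toFun σ x v + (fderivChart f x v) • σ x := by
  have hre : MDifferentiableAt 𝓘(ℝ, V) 𝓘(ℝ, ℝ) (fun y => (f y).re) x :=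
    MDifferentiableAt.comp (g := Complex.reCLM) x Complex.reCLM.mdifferentiableAt hf
  have him : MDifferentiableAt 𝓘(ℝ, V) 𝓘(ℝ, ℝ) (fun y => (f y).im) x :=
    MDifferentiableAt.comp (g := Complex.imCLM) x Complex.imCLM.mdifferentiableAt hf
  have hI := hσ.const_smul Complex.I
  have h1 : E.DiffAt (fun y => (f y).re • σ y) x := hre.smul_section hσ
  have h2 : E.DiffAt (fun y => (f y).im • (Complex.I • σ y)) x := him.smul_section hI
  have hsplit : ∀ (z : ℂ) (y : M) (e : E.Fiber y), z.re • e + z.im • (Complex.I • e) = z • e := by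
    intro z y e
    rw [← Complex.coe_smul z.re, ← Complex.coe_smul z.im, smul_smul, ← add_smul, Complex.re_add_im]
  have hfun : (fun y => f y • σ y) =
      fun y => (f y).re • σ y + (f y).im • (Complex.I • σ y) :=
    funext fun y => (hsplit _ y _).symm
  have hdre : fderivChart (fun y => (f y).re) x v = (fderivChart f x v).re := by
    have := (Complex.reCLM.hasFDerivAt.comp _ hf.comp_chart_symm.hasFDerivAt).fderiv
    exact congrArg (fun L => L v) this
  have hdim : fderivChart (fun y => (f y).im) x v = (fderivChart f x v).im := by
    have := (Complex.imCLM.hasFDerivAt.comp _ hf.comp_chart_symm.hasFDerivAt).fderiv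
    exact congrArg (fun L => L v) this
  have hadd : D.toFun (fun y => (f y).re • σ y + (f y).im • (Complex.I • σ y)) x v =
      D.toFun (fun y => (f y).re • σ y) x v + D.toFun (fun y => (f y).im • (Complex.I • σ y)) x v :=
    congrArg (fun L => L v) (D.toFun_add h1 h2)
  have hsm : D.toFun (fun y => Complex.I • σ y) x v = Complex.I • D.toFun σ x v :=
    D.map_smul _ _ _ _ hσ
  rw [hfun, hadd, D.toFun_real_smul hσ hre,
    D.toFun_real_smul hI him, hsm, hdre, hdim]
  rw [← hsplit (f x), ← hsplit (fderivChart f x v)]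
  abel

lemma toFun_sum {κ : Type*} (s : Finset κ) {σ : κ → ∀ y, E.Fiber y} {x : M}
    (hσ : ∀ i ∈ s, E.DiffAt (σ i) x) :
    D.toFun (fun y => ∑ i ∈ s, σ i y) x = ∑ i ∈ s, D.toFun (σ i) x := by
  classical
  induction s using Finset.induction_on with
  | empty =>
    simp only [Finset.sum_empty]
    exact D.isCovariantDerivativeOnUniv.zero
  | insert a s ha ih =>
    have hs : ∀ i ∈ s, E.DiffAt (σ i) x := fun i hi => hσ i (Finset.mem_insert_of_mem hi)
    simp only [Finset.sum_insert ha]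
    rw [D.toFun_add (hσ a (Finset.mem_insert_self a s)) (HermitianBundle.DiffAt.sum hs), ih hs]

/-- The bracket of two coordinate fields of the preferred chart at `x` vanishes at `x`. -/
lemma mlieBracket_extend_extend {x : M} (v w : TangentSpace 𝓘(ℝ, V) x) :
    VectorField.mlieBracket 𝓘(ℝ, V) (fun y => FiberBundle.extend V v y : ∀ y : M, TangentSpace 𝓘(ℝ, V) y)
      (FiberBundle.extend V w) x = 0 := by
  -- Pulled back to the chart, the extended fields are constant, so their bracket in the model space
  -- is zero.
  have key : ∀ v : TangentSpace 𝓘(ℝ, V) x,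
      VectorField.mpullbackWithin 𝓘(ℝ, V) 𝓘(ℝ, V) (extChartAt 𝓘(ℝ, V) x).symm
        (FiberBundle.extend V v : ∀ y : M, TangentSpace 𝓘(ℝ, V) y) (range 𝓘(ℝ, V)) =ᶠ[𝓝 (chartAt V x x)]
        fun _ => (v : V) := by
    intro v
    filter_upwards [(chartAt V x).open_target.mem_nhds (mem_chart_target V x)] with y hy
    rw [VectorField.mpullbackWithin_apply]
    have h1 := extend_tangent_eq ((chartAt V x).map_target hy) v
    rw [(chartAt V x).right_inv hy] at h1
    have h2 : mfderivWithin 𝓘(ℝ, V) 𝓘(ℝ, V) (extChartAt 𝓘(ℝ, V) x).symm (range 𝓘(ℝ, V)) y =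
        chartDeriv x y := by
      simp [chartDeriv, mfld_simps]
      rfl
    obtain ⟨K, hK1, hK2⟩ := exists_chartDeriv_inverse x hy
    have h3 : (chartDeriv x y).inverse = K := ContinuousLinearMap.inverse_eq hK2 hK1
    have h4 : K (chartDeriv x y v) = v := congrArg (fun f : V →L[ℝ] V => f v) hK1
    have h5 : (mfderivWithin 𝓘(ℝ, V) 𝓘(ℝ, V) (extChartAt 𝓘(ℝ, V) x).symm (range 𝓘(ℝ, V)) y).inverse
        = K := by rw [h2]; exact h3
    rw [h5]
    refine Eq.trans ?_ h4
    exact congrArg K h1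
  rw [VectorField.mlieBracket, VectorField.mlieBracketWithin_apply]
  have h0 : VectorField.lieBracketWithin ℝ
      (VectorField.mpullbackWithin 𝓘(ℝ, V) 𝓘(ℝ, V) (extChartAt 𝓘(ℝ, V) x).symm
        (FiberBundle.extend V v : ∀ y : M, TangentSpace 𝓘(ℝ, V) y) (range 𝓘(ℝ, V)))
      (VectorField.mpullbackWithin 𝓘(ℝ, V) 𝓘(ℝ, V) (extChartAt 𝓘(ℝ, V) x).symm
        (FiberBundle.extend V w : ∀ y : M, TangentSpace 𝓘(ℝ, V) y) (range 𝓘(ℝ, V)))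
      ((extChartAt 𝓘(ℝ, V) x).symm ⁻¹' univ ∩ range 𝓘(ℝ, V)) (extChartAt 𝓘(ℝ, V) x x) = 0 := by
    have hu : ((extChartAt 𝓘(ℝ, V) x).symm ⁻¹' univ ∩ range 𝓘(ℝ, V) : Set V) = univ := by simp
    have hx : extChartAt 𝓘(ℝ, V) x x = chartAt V x x := by simp [mfld_simps]
    rw [hu, hx]
    exact lieBracketWithin_univ_eq_zero (key v) (key w)
  exact (congrArg _ h0).trans (map_zero _)

end UnitaryConnection

/-! ### Differences of connections, trace of the curvature, independence of the degree. -/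

namespace UnitaryConnection

open HermitianBundle

variable {V : Type u} [NormedAddCommGroup V] [NormedSpace ℂ V]
  {M : Type v} [TopologicalSpace M] [ChartedSpace V M] [IsManifold 𝓘(ℂ, V) ω M]
  {E : HermitianBundle.{u, v, w} V M} (B D : UnitaryConnection E)

/-- The connection matrix of `D` in the preferred frame at `x`, as an endomorphism of the fibre. -/
def connMatrix (x : M) (v : TangentSpace 𝓘(ℝ, V) x) : E.Fiber x →ₗ[ℂ] E.Fiber x :=
  ∑ i, (E.coef x i x).smulRight (D.toFun (E.frame x i) x v)

/-- The difference `B - D` of two connections, an endomorphism valued one-form. -/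
def connDiff (x : M) (v : TangentSpace 𝓘(ℝ, V) x) : E.Fiber x →ₗ[ℂ] E.Fiber x :=
  B.connMatrix x v - D.connMatrix x v

lemma connMatrix_apply (x : M) (v : TangentSpace 𝓘(ℝ, V) x) (e : E.Fiber x) :
    D.connMatrix x v e = ∑ i, E.coef x i x e • D.toFun (E.frame x i) x v := by
  simp [connMatrix]

lemma connMatrix_frame (x : M) (v : TangentSpace 𝓘(ℝ, V) x) (i : Fin E.rank) :
    D.connMatrix x v (E.frame x i x) = D.toFun (E.frame x i) x v := by
  simp [connMatrix_apply, coef_frame]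

/-- The covariant derivative in the preferred frame. -/
lemma toFun_eq_connMatrix {σ : ∀ y, E.Fiber y} {x : M} (hσ : E.DiffAt σ x)
    (v : TangentSpace 𝓘(ℝ, V) x) :
    D.toFun σ x v = D.connMatrix x v (σ x) +
      ∑ i, (fderivChart (V := V) (fun y => E.coef x i y (σ y)) x v) • E.frame x i x := by
  have hd : ∀ i, E.DiffAt (fun y => E.coef x i y (σ y) • E.frame x i y) x := fun i =>
    (smoothAt_frame x i).diffAt.complex_smul (hσ.coef i)
  have h1 : D.toFun σ x = D.toFun (fun y => ∑ i, E.coef x i y (σ y) • E.frame x i y) x :=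
    D.toFun_congr hσ (DiffAt.sum fun i _ => hd i) (by
      filter_upwards [E.baseSet_mem_nhds x] with y hy
      exact (sum_coef_smul_frame hy _).symm)
  rw [h1, D.toFun_sum _ fun i _ => hd i, sum_apply, connMatrix_apply, ← Finset.sum_add_distrib]
  exact Finset.sum_congr rfl fun i _ =>
    D.toFun_complex_smul (smoothAt_frame x i).diffAt (hσ.coef i) v

/-- The terms differentiating the coefficients are common to both connections and cancel, so the
difference is tensorial and does not depend on the frame used to define it. -/
lemma connDiff_apply {σ : ∀ y, E.Fiber y} {x : M} (hσ : E.DiffAt σ x)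
    (v : TangentSpace 𝓘(ℝ, V) x) : B.connDiff D x v (σ x) = B.toFun σ x v - D.toFun σ x v := by
  rw [B.toFun_eq_connMatrix hσ, D.toFun_eq_connMatrix hσ, connDiff, LinearMap.sub_apply,
    add_sub_add_right_eq_sub]

/-- The trace of the difference of two connections along the coordinate field with value `w`. -/
def traceAlong (x : M) (w : TangentSpace 𝓘(ℝ, V) x) (p : M) : ℂ :=
  LinearMap.trace ℂ (E.Fiber p) (B.connDiff D p (FiberBundle.extend V w p))

/-- The matrix of the difference of two connections, along the coordinate field with value `w`. -/
def diffCoef (x : M) (w : TangentSpace 𝓘(ℝ, V) x) (i j : Fin E.rank) (p : M) : ℂ :=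
  E.coef x j p (B.toFun (E.frame x i) p (FiberBundle.extend V w p) -
    D.toFun (E.frame x i) p (FiberBundle.extend V w p))

lemma diffAt_diff (x : M) (w : TangentSpace 𝓘(ℝ, V) x) (i : Fin E.rank) :
    E.DiffAt (fun p => B.toFun (E.frame x i) p (FiberBundle.extend V w p) -
      D.toFun (E.frame x i) p (FiberBundle.extend V w p)) x :=
  (B.diffAt_toFun (smoothAt_frame x i) w).sub (D.diffAt_toFun (smoothAt_frame x i) w)

lemma mdifferentiableAt_diffCoef (x : M) (w : TangentSpace 𝓘(ℝ, V) x) (i j : Fin E.rank) :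
    MDifferentiableAt 𝓘(ℝ, V) 𝓘(ℝ, ℂ) (B.diffCoef D x w i j) x :=
  (B.diffAt_diff D x w i).coef j

/-- `connDiff` at `p` is defined by the frame centred at `p`; tensoriality allows the fixed frame at
`x` instead, which makes the trace differentiable at `x`. -/
lemma traceAlong_eventuallyEq (x : M) (w : TangentSpace 𝓘(ℝ, V) x) :
    ∀ᶠ p in 𝓝 x, B.traceAlong D x w p = ∑ i, B.diffCoef D x w i i p := by
  filter_upwards [E.baseSet_mem_nhds x,
    eventually_all.2 fun i => (smoothAt_frame (E := E) x i).eventually] with p hp hd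
  rw [traceAlong, trace_eq_sum_coef hp]
  exact Finset.sum_congr rfl fun i _ => by rw [connDiff_apply B D (hd i)]; rfl

/-- With `B = D + a` and `D = d + θ` in the frame, this is the expansion `∇ᴮ∇ᴮ - ∇ᴰ∇ᴰ = ∇ᴰ a + a ∇ᴰ
+ a a`, evaluated on a frame section, with `∇ᴰ a` split into `θ a` and the derivative of the entries
of `a`. -/
lemma second_derivative_diff (x : M) (v w : TangentSpace 𝓘(ℝ, V) x) (i : Fin E.rank) :
    B.toFun (fun p => B.toFun (E.frame x i) p (FiberBundle.extend V w p)) x v -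
      D.toFun (fun p => D.toFun (E.frame x i) p (FiberBundle.extend V w p)) x v =
    D.connMatrix x v (B.connDiff D x w (E.frame x i x)) +
      ∑ j, (fderivChart (V := V) (B.diffCoef D x w i j) x v) • E.frame x j x +
      B.connDiff D x v (D.connMatrix x w (E.frame x i x)) +
      B.connDiff D x v (B.connDiff D x w (E.frame x i x)) := by
  have hW := B.diffAt_toFun (smoothAt_frame x i) w
  have hS := D.diffAt_toFun (smoothAt_frame x i) w
  have hT := B.diffAt_diff D x w i
  have hx : FiberBundle.extend V w x = w := FiberBundle.extend_apply_self V w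
  have h1 := B.connDiff_apply D hW v
  have h2 : D.toFun (fun p => B.toFun (E.frame x i) p (FiberBundle.extend V w p)) x v =
      D.toFun (fun p => D.toFun (E.frame x i) p (FiberBundle.extend V w p)) x v +
      D.toFun (fun p => B.toFun (E.frame x i) p (FiberBundle.extend V w p) -
        D.toFun (E.frame x i) p (FiberBundle.extend V w p)) x v := by
    have := congrArg (fun L => L v) (D.toFun_add hS hT)
    refine Eq.trans ?_ this
    simp only [add_sub_cancel]
  have h3 : D.toFun (fun p => B.toFun (E.frame x i) p (FiberBundle.extend V w p) -
        D.toFun (E.frame x i) p (FiberBundle.extend V w p)) x v =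
      D.connMatrix x v (B.toFun (E.frame x i) x (FiberBundle.extend V w x) -
        D.toFun (E.frame x i) x (FiberBundle.extend V w x)) +
      ∑ j, (fderivChart (V := V) (B.diffCoef D x w i j) x v) • E.frame x j x :=
    D.toFun_eq_connMatrix hT v
  have h4 := B.connDiff_apply D (smoothAt_frame (E := E) x i).diffAt w
  simp only [hx] at h1 h3
  rw [← h4] at h3
  have h5 : B.toFun (E.frame x i) x w =
      D.connMatrix x w (E.frame x i x) + B.connDiff D x w (E.frame x i x) := by
    rw [h4, connMatrix_frame, add_sub_cancel]
  rw [h5, map_add] at h1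
  rw [h3] at h2
  rw [eq_sub_iff_add_eq.1 h1 |>.symm, h2]
  abel

/-- A frame section is the extension of its own value at `x`, and the coordinate fields commute
there, so the bracket term drops out. -/
lemma curvature_frame (x : M) (v w : TangentSpace 𝓘(ℝ, V) x) (i : Fin E.rank) :
    D.curvature x v w (E.frame x i x) =
      D.toFun (fun p => D.toFun (E.frame x i) p (FiberBundle.extend V w p)) x v -
      D.toFun (fun p => D.toFun (E.frame x i) p (FiberBundle.extend V v p)) x w := by
  have hframe : E.frame x i x = E.frameBasis (E.mem_baseSet x) i := frame_eq (E.mem_baseSet x) i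
  have h : D.curvature x v w (E.frame x i x) = D.curvatureSection (FiberBundle.extend V v)
      (FiberBundle.extend V w) (E.frame x i) x := by
    rw [hframe]; rfl
  have h0 : D.toFun (E.frame x i) x (VectorField.mlieBracket 𝓘(ℝ, V) (FiberBundle.extend V v)
      (FiberBundle.extend V w) x) = 0 := by
    rw [mlieBracket_extend_extend, map_zero]
  rw [h, curvatureSection, h0, sub_zero]
  have hv : FiberBundle.extend V v x = v := FiberBundle.extend_apply_self V v
  have hw : FiberBundle.extend V w x = w := FiberBundle.extend_apply_self V w
  rw [hv, hw]

/-- The trace of the difference of two curvatures is the exterior derivative of the trace of the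
difference of the connections. -/
lemma trace_curvature_sub (x : M) (v w : TangentSpace 𝓘(ℝ, V) x) :
    LinearMap.trace ℂ (E.Fiber x) (B.curvature x v w) -
      LinearMap.trace ℂ (E.Fiber x) (D.curvature x v w) =
    fderivChart (V := V) (B.traceAlong D x w) x v - fderivChart (V := V) (B.traceAlong D x v) x w := by
  have hder : ∀ v w : TangentSpace 𝓘(ℝ, V) x, fderivChart (V := V) (B.traceAlong D x w) x v =
      ∑ i, fderivChart (V := V) (B.diffCoef D x w i i) x v := by
    intro v w
    have h1 : (B.traceAlong D x w) ∘ (chartAt V x).symm =ᶠ[𝓝 (chartAt V x x)]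
        fun y => ∑ i, (B.diffCoef D x w i i ∘ (chartAt V x).symm) y := by
      have h2 : Tendsto (chartAt V x).symm (𝓝 (chartAt V x x)) (𝓝 x) := by
        have := (chartAt V x).continuousAt_symm (mem_chart_target V x)
        rwa [ContinuousAt, (chartAt V x).left_inv (mem_chart_source V x)] at this
      filter_upwards [h2.eventually (B.traceAlong_eventuallyEq D x w)] with y hy
      exact hy
    have h3 : fderivChart (V := V) (B.traceAlong D x w) x =
        ∑ i, fderivChart (V := V) (B.diffCoef D x w i i) x := by
      rw [fderivChart, h1.fderiv_eq, fderiv_fun_sum fun i _ =>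
        (B.mdifferentiableAt_diffCoef D x w i i).comp_chart_symm]
      rfl
    have h4 := congrArg (fun L : V →L[ℝ] ℂ => L v) h3
    refine Eq.trans h4 ?_
    exact sum_apply ..
  have hx := E.mem_baseSet x
  set θ := D.connMatrix x
  set a := B.connDiff D x
  have hi : ∀ i, E.coef x i x (B.curvature x v w (E.frame x i x)) -
      E.coef x i x (D.curvature x v w (E.frame x i x)) =
      E.coef x i x ((θ v * a w + a v * θ w + a v * a w - θ w * a v - a w * θ v - a w * a v)
        (E.frame x i x)) + (fderivChart (V := V) (B.diffCoef D x w i i) x v -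
          fderivChart (V := V) (B.diffCoef D x v i i) x w) := by
    intro i
    have hs : ∀ v w : TangentSpace 𝓘(ℝ, V) x, E.coef x i x
        (∑ j, (fderivChart (V := V) (B.diffCoef D x w i j) x v) • E.frame x j x) =
        fderivChart (V := V) (B.diffCoef D x w i i) x v := by
      intro v w
      simp [coef_frame]
    rw [← hs v w, ← hs w v, ← map_sub, ← map_sub, ← map_add]
    congr 1
    have h1 := B.second_derivative_diff D x v w i
    have h2 := B.second_derivative_diff D x w v i
    rw [B.curvature_frame, D.curvature_frame, sub_sub_sub_comm, h1, h2]
    simp only [LinearMap.sub_apply, LinearMap.add_apply, Module.End.mul_apply]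
    abel
  rw [trace_eq_sum_coef hx, trace_eq_sum_coef hx, ← Finset.sum_sub_distrib,
    Finset.sum_congr rfl fun i _ => hi i, Finset.sum_add_distrib, ← trace_eq_sum_coef hx,
    Finset.sum_sub_distrib, ← hder, ← hder]
  simp only [map_sub, map_add]
  -- The products form the commutators `[θ v, a w]`, `[a v, θ w]` and `[a v, a w]`, all of trace
  -- zero; only the exterior derivative is left.
  rw [LinearMap.trace_mul_comm ℂ (θ v) (a w), LinearMap.trace_mul_comm ℂ (θ w) (a v),
    LinearMap.trace_mul_comm ℂ (a v) (a w)]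
  ring

/-- The coefficients of the covariant derivative along the coordinate fields of a chart. -/
lemma contDiffAt_coef_toFun {σ : ∀ y, E.Fiber y} (c : M) {y : V} (hy : y ∈ (chartAt V c).target)
    (hσ : E.SmoothAt σ ((chartAt V c).symm y)) (v : V) (i : Fin E.rank) :
    ContDiffAt ℝ ∞ (fun z => E.coef ((chartAt V c).symm y) i ((chartAt V c).symm z)
      (D.toFun σ ((chartAt V c).symm z) (chartVector V c z v))) y := by
  have : IsManifold 𝓘(ℝ, V) 1 M := isManifold_real_of_complex 1
  set x := (chartAt V c).symm y
  have h1 := ContMDiffAt.comp y (D.smooth σ x hσ)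
    ((contMDiffAt_chart_symm c hy).of_le (n := ω) (m := ∞) le_top)
  have h2 := ContMDiffAt.clm_bundle_apply (F₁ := V) (F₂ := E.F) h1 (contMDiffAt_chartVector c hy v)
  have h3 := (contMDiffAt_totalSpace.1 h2).2
  have h4 := (E.coordCLM i).contDiff.contDiffAt.comp y (contMDiffAt_iff_contDiffAt.1 h3)
  refine h4.congr_of_eventuallyEq ?_
  filter_upwards [((chartAt V c).continuousAt_symm hy).preimage_mem_nhds (E.baseSet_mem_nhds x)]
    with z hz
  have h5 : ∀ e : E.Fiber ((chartAt V c).symm z), E.coef x i ((chartAt V c).symm z) e =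
      E.coordCLM i (trivializationAt E.F E.Fiber x ⟨(chartAt V c).symm z, e⟩).2 := by
    intro e
    simp only [HermitianBundle.coef, LinearMap.comp_apply]
    rw [Trivialization.coe_linearMapAt_of_mem _ hz]
    rfl
  exact h5 _

lemma connDiff_add (x : M) (v w : TangentSpace 𝓘(ℝ, V) x) :
    B.connDiff D x (v + w) = B.connDiff D x v + B.connDiff D x w := by
  ext e
  simp only [connDiff, connMatrix_apply, LinearMap.sub_apply, LinearMap.add_apply, map_add,
    smul_add, Finset.sum_add_distrib]
  abel

lemma connDiff_real_smul (x : M) (r : ℝ) (v : TangentSpace 𝓘(ℝ, V) x) :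
    B.connDiff D x (r • v) = (r : ℂ) • B.connDiff D x v := by
  have hsm : ∀ (C : UnitaryConnection E) (i : Fin E.rank), C.toFun (E.frame x i) x (r • v) =
      (r : ℂ) • C.toFun (E.frame x i) x v := fun C i =>
    (_root_.map_smul (C.toFun (E.frame x i) x) r v).trans (Complex.coe_smul r _).symm
  ext e
  simp only [connDiff, connMatrix_apply, LinearMap.sub_apply, LinearMap.smul_apply, hsm, smul_sub,
    Finset.smul_sum, smul_comm (r : ℂ)]

variable [FiniteDimensional ℂ V]

/-- The real one-form `Re (i tr (B - D))` of two connections `B`, `D`. -/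
def connForm (x : M) : V →L[ℝ] ℝ :=
  LinearMap.toContinuousLinearMap
    -- `Re (i z) = -Im z`.
    { toFun := fun v => -(LinearMap.trace ℂ (E.Fiber x) (B.connDiff D x v)).im
      map_add' := fun v w => by
        have h := congrArg (fun L => -(LinearMap.trace ℂ (E.Fiber x) L).im) (B.connDiff_add D x v w)
        refine h.trans ?_
        simp only [_root_.map_add, Complex.add_im, neg_add]
      map_smul' := fun r v => by
        have h := congrArg (fun L => -(LinearMap.trace ℂ (E.Fiber x) L).im)
          (B.connDiff_real_smul D x r v)
        refine h.trans ?_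
        simp only [_root_.map_smul, smul_eq_mul, Complex.im_ofReal_mul, RingHom.id_apply, mul_neg] }

lemma isC1Form_connForm : IsC1Form (B.connForm D) := by
  intro c y hy
  have hon : ContDiffOn ℝ 1 (chartForm (B.connForm D) c) (chartAt V c).target := by
    refine contDiffOn_clm_apply.2 fun v y hy => ContDiffAt.contDiffWithinAt ?_
    set x := (chartAt V c).symm y with hx
    have h1 : ContDiffAt ℝ 1 (fun z => ∑ i,
        (E.coef x i ((chartAt V c).symm z)
          (B.toFun (E.frame x i) ((chartAt V c).symm z) (chartVector V c z v)) -
        E.coef x i ((chartAt V c).symm z)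
          (D.toFun (E.frame x i) ((chartAt V c).symm z) (chartVector V c z v)))) y :=
      ContDiffAt.sum fun i _ =>
        ((B.contDiffAt_coef_toFun c hy (smoothAt_frame x i) v i).of_le (by simp)).sub
          ((D.contDiffAt_coef_toFun c hy (smoothAt_frame x i) v i).of_le (by simp))
    have h2 := (Complex.imCLM.contDiff.contDiffAt.comp y h1).neg
    refine h2.congr_of_eventuallyEq ?_
    filter_upwards [((chartAt V c).continuousAt_symm hy).preimage_mem_nhds (E.baseSet_mem_nhds x),
      ((chartAt V c).continuousAt_symm hy).eventually (eventually_all.2 fun i =>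
        (smoothAt_frame (E := E) x i).eventually)] with z hz hd
    have h3 : chartForm (B.connForm D) c z v = -(LinearMap.trace ℂ (E.Fiber ((chartAt V c).symm z))
      (B.connDiff D ((chartAt V c).symm z) (chartVector V c z v))).im := rfl
    rw [h3, trace_eq_sum_coef hz]
    have h4 : ∀ i, E.coef x i ((chartAt V c).symm z)
        (B.connDiff D ((chartAt V c).symm z) (chartVector V c z v)
          (E.frame x i ((chartAt V c).symm z))) =
        E.coef x i ((chartAt V c).symm z)
          (B.toFun (E.frame x i) ((chartAt V c).symm z) (chartVector V c z v)) -
        E.coef x i ((chartAt V c).symm z)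
          (D.toFun (E.frame x i) ((chartAt V c).symm z) (chartVector V c z v)) := fun i => by
      rw [connDiff_apply B D (hd i), map_sub]
    rw [Finset.sum_congr rfl fun i _ => h4 i]
    rfl
  exact hon.contDiffAt ((chartAt V c).open_target.mem_nhds hy)

/-- The exterior derivative at `x` uses the preferred chart at `x`, whose coordinate fields are the
extensions appearing in `traceAlong`; the identity is thus minus the imaginary part of
`trace_curvature_sub`. -/
lemma formExtD_connForm (x : M) (v w : V) : formExtD (B.connForm D) x v w =
    -(LinearMap.trace ℂ (E.Fiber x) (B.curvature x v w) -
      LinearMap.trace ℂ (E.Fiber x) (D.curvature x v w)).im := by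
  have key : ∀ v w : V, fderiv ℝ (chartForm (B.connForm D) x) (chartAt V x x) v w =
      -(fderivChart (V := V) (B.traceAlong D x w) x v).im := by
    intro v w
    have hd : DifferentiableAt ℝ (chartForm (B.connForm D) x) (chartAt V x x) :=
      (B.isC1Form_connForm D x _ (mem_chart_target V x)).differentiableAt (by simp)
    have h1 : fderiv ℝ (fun y => chartForm (B.connForm D) x y w) (chartAt V x x) v =
        fderiv ℝ (chartForm (B.connForm D) x) (chartAt V x x) v w := by
      rw [(hd.hasFDerivAt.clm_apply (hasFDerivAt_const w _)).fderiv]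
      simp
    have hT : DifferentiableAt ℝ (B.traceAlong D x w ∘ (chartAt V x).symm) (chartAt V x x) := by
      have h2 : Tendsto (chartAt V x).symm (𝓝 (chartAt V x x)) (𝓝 x) := by
        have := (chartAt V x).continuousAt_symm (mem_chart_target V x)
        rwa [ContinuousAt, (chartAt V x).left_inv (mem_chart_source V x)] at this
      have hs : DifferentiableAt ℝ (fun y => ∑ i, (B.diffCoef D x w i i ∘ (chartAt V x).symm) y)
          (chartAt V x x) := DifferentiableAt.fun_sum fun i _ =>
        (B.mdifferentiableAt_diffCoef D x w i i).comp_chart_symm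
      exact hs.congr_of_eventuallyEq (h2.eventually (B.traceAlong_eventuallyEq D x w))
    have h2 : (fun y => chartForm (B.connForm D) x y w) =ᶠ[𝓝 (chartAt V x x)]
        fun y => -(B.traceAlong D x w ∘ (chartAt V x).symm) y |>.im := by
      filter_upwards [(chartAt V x).open_target.mem_nhds (mem_chart_target V x)] with y hy
      have h3 := extend_tangent_eq ((chartAt V x).map_target hy) w
      rw [(chartAt V x).right_inv hy] at h3
      have h4 : B.traceAlong D x w ((chartAt V x).symm y) = LinearMap.trace ℂ _
          (B.connDiff D ((chartAt V x).symm y) (chartDeriv x y w)) := by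
        exact congrArg (fun u => LinearMap.trace ℂ _ (B.connDiff D ((chartAt V x).symm y) u)) h3
      simp only [Function.comp_apply, Complex.neg_im]
      rw [h4]
      rfl
    rw [← h1, h2.fderiv_eq]
    have h5 := (Complex.imCLM.hasFDerivAt.comp _ hT.hasFDerivAt.neg).fderiv
    have h6 := congrArg (fun L : V →L[ℝ] ℝ => L v) h5
    refine Eq.trans h6 ?_
    simp [fderivChart]
  have h := congrArg Complex.im (B.trace_curvature_sub D x v w)
  rw [formExtD, chartExtD_apply, key v w, key w v]
  refine Eq.trans ?_ (congrArg Neg.neg h.symm)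
  rw [Complex.sub_im]
  ring

variable (g : KahlerMetric V M)

/-- The Chern-Weil identity after contraction. The coefficients of `Λ` are real, so the real part of
`i Λ tr F` involves only `-Im tr F`, which changes by `dα`. -/
lemma re_trace_curvatureAlong_sub (x : M) :
    (LinearMap.trace ℂ (E.Fiber x) (B.curvatureAlong g x)).re -
      (LinearMap.trace ℂ (E.Fiber x) (D.curvatureAlong g x)).re =
    g.realContraction x (formExtD (B.connForm D) x) := by
  have h : ∀ C : UnitaryConnection E, (LinearMap.trace ℂ (E.Fiber x) (C.curvatureAlong g x)).re =
      1 / 2 * ∑ k, ∑ l, (g.gram x)⁻¹ k l * -(LinearMap.trace ℂ (E.Fiber x) (C.curvature x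
        (Module.finBasis ℝ V k : V) (Complex.I • Module.finBasis ℝ V l : V))).im := by
    intro C
    have h1 : LinearMap.trace ℂ (E.Fiber x) (C.curvatureAlong g x) =
        Complex.I * ((1 / 2 : ℂ) * ∑ k, ∑ l, (((g.gram x)⁻¹ k l : ℝ) : ℂ) *
          LinearMap.trace ℂ (E.Fiber x) (C.curvature x
            (Module.finBasis ℝ V k : V) (Complex.I • Module.finBasis ℝ V l : V))) := by
      simp only [curvatureAlong, KahlerMetric.contraction, _root_.map_smul, _root_.map_sum, smul_eq_mul]
      rfl
    have h2 : ((1 / 2 : ℂ) * ∑ k, ∑ l, (((g.gram x)⁻¹ k l : ℝ) : ℂ) *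
          LinearMap.trace ℂ (E.Fiber x) (C.curvature x
            (Module.finBasis ℝ V k : V) (Complex.I • Module.finBasis ℝ V l : V))) =
        ((1 / 2 : ℝ) : ℂ) * ∑ k, ∑ l, (((g.gram x)⁻¹ k l : ℝ) : ℂ) *
          LinearMap.trace ℂ (E.Fiber x) (C.curvature x
            (Module.finBasis ℝ V k : V) (Complex.I • Module.finBasis ℝ V l : V)) := by
      push_cast
      rfl
    rw [h1, h2, Complex.I_mul_re, Complex.im_ofReal_mul, Complex.im_sum]
    simp only [Complex.im_sum, Complex.im_ofReal_mul, mul_neg, Finset.sum_neg_distrib]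
  rw [h B, h D, KahlerMetric.realContraction, ← mul_sub, ← Finset.sum_sub_distrib]
  congr 1
  refine Finset.sum_congr rfl fun k _ => ?_
  rw [← Finset.sum_sub_distrib]
  refine Finset.sum_congr rfl fun l _ => ?_
  rw [formExtD_connForm, Complex.sub_im]
  ring

variable [MeasurableSpace V] [BorelSpace V] [T2Space M] [CompactSpace M]

/-- The degree does not depend on the connection. -/
theorem topOne_eq_topOne
    (hD : Continuous fun x => (LinearMap.trace ℂ (E.Fiber x) (D.curvatureAlong g x)).re) :
    B.topOne g = D.topOne g := by
  have h : (fun x => (LinearMap.trace ℂ (E.Fiber x) (B.curvatureAlong g x)).re) = fun x =>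
      (LinearMap.trace ℂ (E.Fiber x) (D.curvatureAlong g x)).re +
        g.realContraction x (formExtD (B.connForm D) x) := by
    funext x
    rw [← re_trace_curvatureAlong_sub]
    ring
  -- Splitting the integral needs both summands continuous: the exact part always is, and for `D`
  -- this is `hD`, available when an equation for its curvature is known.
  rw [topOne, h, g.integral_add hD
    (g.continuous_realContraction_formExtD (B.isC1Form_connForm D)),
    g.integral_realContraction_formExtD (B.isC1Form_connForm D), add_zero, topOne]

end UnitaryConnection

/-! ### Traces of `f* f` and pointwise norms of Higgs fields. -/

/-- The trace of `f* f` in an arbitrary basis. -/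
lemma LinearMap.trace_adjoint_comp_self {H K : Type*} [NormedAddCommGroup H] [InnerProductSpace ℂ H]
    [FiniteDimensional ℂ H] [NormedAddCommGroup K] [InnerProductSpace ℂ K] [FiniteDimensional ℂ K]
    {ι : Type*} [Fintype ι] [DecidableEq ι] (b : Module.Basis ι ℂ H) (f : H →ₗ[ℂ] K) :
    IsUnit (Matrix.of fun i j => ⟪b i, b j⟫_ℂ).det ∧
    LinearMap.trace ℂ H (f.adjoint ∘ₗ f) = Matrix.trace ((Matrix.of fun i j => ⟪b i, b j⟫_ℂ)⁻¹ *
      Matrix.of fun i j => ⟪f (b i), f (b j)⟫_ℂ) := by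
  set G : Matrix ι ι ℂ := Matrix.of fun i j => ⟪b i, b j⟫_ℂ with hG
  -- A kernel vector of the Gram matrix gives a combination of the basis with zero norm.
  have hinv : IsUnit G.det := by
    rw [← Matrix.isUnit_iff_isUnit_det, ← Matrix.mulVec_injective_iff_isUnit]
    refine (injective_iff_map_eq_zero' (Matrix.mulVecLin G)).2 fun c => ⟨fun hc => ?_, fun hc => by
      rw [hc, map_zero]⟩
    have h1 : ∀ i, ⟪b i, ∑ j, c j • b j⟫_ℂ = 0 := fun i => by
      have := congrFun hc i
      simp only [Matrix.mulVecLin_apply, Matrix.mulVec, dotProduct, hG, Matrix.of_apply,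
        Pi.zero_apply] at this
      rw [inner_sum, ← this]
      exact Finset.sum_congr rfl fun j _ => by rw [inner_smul_right, mul_comm]
    have h2 : ∑ j, c j • b j = 0 := inner_self_eq_zero (𝕜 := ℂ).1 <| by
      rw [sum_inner]
      exact Finset.sum_eq_zero fun i _ => by rw [inner_smul_left, h1, mul_zero]
    exact funext fun j => Fintype.linearIndependent_iff.1 b.linearIndependent c h2 j
  refine ⟨hinv, ?_⟩
  have h : G * LinearMap.toMatrix b b (f.adjoint ∘ₗ f) =
      Matrix.of fun i j => ⟪f (b i), f (b j)⟫_ℂ := by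
    ext i j
    simp only [Matrix.mul_apply, hG, Matrix.of_apply, LinearMap.toMatrix_apply]
    rw [← LinearMap.adjoint_inner_right, ← LinearMap.comp_apply,
      ← b.sum_repr ((f.adjoint ∘ₗ f) (b j)), inner_sum]
    refine Finset.sum_congr rfl fun k _ => ?_
    rw [inner_smul_right, mul_comm, b.sum_repr]
  rw [← h, ← Matrix.mul_assoc, Matrix.nonsing_inv_mul _ hinv, one_mul,
    LinearMap.trace_eq_matrix_trace ℂ b]

section

variable {H K : Type*} [NormedAddCommGroup H] [InnerProductSpace ℂ H]
    [FiniteDimensional ℂ H] [NormedAddCommGroup K] [InnerProductSpace ℂ K] [FiniteDimensional ℂ K]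

lemma LinearMap.re_trace_adjoint_comp_self (f : H →ₗ[ℂ] K) :
    (LinearMap.trace ℂ H (f.adjoint ∘ₗ f)).re =
      ∑ i, ‖f (stdOrthonormalBasis ℂ H i)‖ ^ 2 := by
  rw [LinearMap.trace_eq_sum_inner _ (stdOrthonormalBasis ℂ H), Complex.re_sum]
  refine Finset.sum_congr rfl fun i _ => ?_
  rw [LinearMap.comp_apply, LinearMap.adjoint_inner_right]
  exact (norm_sq_eq_re_inner (𝕜 := ℂ) _).symm

lemma LinearMap.re_trace_adjoint_comp_self_nonneg (f : H →ₗ[ℂ] K) :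
    0 ≤ (LinearMap.trace ℂ H (f.adjoint ∘ₗ f)).re := by
  rw [re_trace_adjoint_comp_self]
  positivity

lemma LinearMap.eq_zero_of_re_trace_adjoint_comp_self {f : H →ₗ[ℂ] K}
    (h : (LinearMap.trace ℂ H (f.adjoint ∘ₗ f)).re = 0) : f = 0 := by
  rw [re_trace_adjoint_comp_self, Finset.sum_eq_zero_iff_of_nonneg fun i _ => by positivity] at h
  exact (stdOrthonormalBasis ℂ H).toBasis.ext fun i => by simpa using h i (Finset.mem_univ i)

end

section

variable {V : Type u} [NormedAddCommGroup V] [NormedSpace ℂ V]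
  {M : Type v} [TopologicalSpace M] [ChartedSpace V M]

open HermitianBundle

namespace BundleMorphism

variable {E₁ E₂ : HermitianBundle.{u, v, w} V M} (φ : BundleMorphism E₁ E₂)

/-- The squared pointwise norm of a morphism of hermitian bundles. -/
def normSq (x : M) : ℝ :=
  (LinearMap.trace ℂ (E₁.Fiber x) ((φ.toFun x).adjoint ∘ₗ φ.toFun x)).re

lemma normSq_nonneg (x : M) : 0 ≤ φ.normSq x := LinearMap.re_trace_adjoint_comp_self_nonneg _

lemma toFun_eq_zero {x : M} (h : φ.normSq x = 0) : φ.toFun x = 0 :=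
  LinearMap.eq_zero_of_re_trace_adjoint_comp_self h

/-- In the frame at `x` the norm is `Re tr (G⁻¹ K)`, with `G` and `K` the Gram matrices of the frame
and of its image. Both are continuous at `x`, so no orthonormal frame is required. -/
lemma continuous_normSq : Continuous φ.normSq := by
  refine continuous_iff_continuousAt.2 fun x => ?_
  have hcont : ∀ (E : HermitianBundle.{u, v, w} V M) (σ : Fin E₁.rank → ∀ y, E.Fiber y),
      (∀ i, E.SmoothAt (σ i) x) →
      ContinuousAt (fun y => Matrix.of fun i j => ⟪σ i y, σ j y⟫_ℂ) x := fun E σ hσ =>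
    continuousAt_pi.2 fun i => continuousAt_pi.2 fun j =>
      (E.smooth_inner (σ i) (σ j) x (hσ i) (hσ j)).continuousAt
  have hG := hcont E₁ (E₁.frame x) (smoothAt_frame x)
  have hK := hcont E₂ (fun i y => φ.toFun y (E₁.frame x i y)) fun i =>
    φ.smooth _ x (smoothAt_frame x i)
  have hbasis : ∀ y (hy : y ∈ E₁.baseSet x),
      IsUnit (Matrix.of fun i j => ⟪E₁.frame x i y, E₁.frame x j y⟫_ℂ).det ∧
      φ.normSq y = (Matrix.trace ((Matrix.of fun i j => ⟪E₁.frame x i y, E₁.frame x j y⟫_ℂ)⁻¹ *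
        Matrix.of fun i j => ⟪φ.toFun y (E₁.frame x i y), φ.toFun y (E₁.frame x j y)⟫_ℂ)).re := by
    intro y hy
    have h := LinearMap.trace_adjoint_comp_self (E₁.frameBasis hy) (φ.toFun y)
    have h' : ∀ i, E₁.frame x i y = E₁.frameBasis hy i := frame_eq hy
    simp only [h']
    exact ⟨h.1, congrArg Complex.re h.2⟩
  have hx := (hbasis x (E₁.mem_baseSet x)).1
  have hinv : ContinuousAt (fun y =>
      (Matrix.of fun i j => ⟪E₁.frame x i y, E₁.frame x j y⟫_ℂ)⁻¹) x := by
    refine ContinuousAt.comp (g := fun A : Matrix _ _ ℂ => A⁻¹) ?_ hG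
    exact continuousAt_matrix_inv _ (NormedRing.inverse_continuousAt hx.unit)
  have h := Complex.continuous_re.continuousAt.comp
    ((continuous_id.matrix_trace).continuousAt.comp (hinv.mul hK))
  refine h.congr ?_
  filter_upwards [E₁.baseSet_mem_nhds x] with y hy
  exact (hbasis y hy).2.symm

end BundleMorphism

lemma HermitianBundle.finrank_fiber (E : HermitianBundle.{u, v, w} V M) (x : M) :
    Module.finrank ℂ (E.Fiber x) = E.rank := by
  rw [Module.finrank_eq_card_basis (E.frameBasis (E.mem_baseSet x)), Fintype.card_fin]

end

/-! ### Traces of the vortex equations and formulas for the degrees. -/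

section

variable {V : Type u} [NormedAddCommGroup V] [NormedSpace ℂ V]
  {M : Type v} [TopologicalSpace M] [ChartedSpace V M]

section Flow

variable {m : ℕ} {E : Fin (m + 1) → HermitianBundle.{u, v, w} V M}
  (φ : ∀ j : Fin m, BundleMorphism (E j.castSucc) (E j.succ))

/-- The trace of `φᵢ ∘ φᵢ*`. -/
def inflow (i : Fin (m + 1)) (x : M) : ℝ :=
  Fin.cases (motive := fun _ => ℝ) 0 (fun j => (φ j).normSq x) i

/-- The trace of `φᵢ₊₁* ∘ φᵢ₊₁`. -/
def outflow (i : Fin (m + 1)) (x : M) : ℝ :=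
  Fin.lastCases (motive := fun _ => ℝ) 0 (fun j => (φ j).normSq x) i

lemma inflow_zero (x : M) : inflow φ 0 x = 0 := rfl

lemma inflow_succ (j : Fin m) (x : M) : inflow φ j.succ x = (φ j).normSq x := rfl

lemma outflow_last (x : M) : outflow φ (Fin.last m) x = 0 := by
  rw [outflow, Fin.lastCases_last]

lemma outflow_castSucc (j : Fin m) (x : M) : outflow φ j.castSucc x = (φ j).normSq x := by
  rw [outflow, Fin.lastCases_castSucc]

lemma continuous_inflow (i : Fin (m + 1)) : Continuous (inflow φ i) := by
  refine Fin.cases ?_ (fun j => ?_) i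
  · exact continuous_const
  · exact (φ j).continuous_normSq

lemma continuous_outflow (i : Fin (m + 1)) : Continuous (outflow φ i) := by
  refine Fin.lastCases ?_ (fun j => ?_) i
  · simp only [funext (outflow_last φ)]
    exact continuous_const
  · simp only [funext (outflow_castSucc φ j)]
    exact (φ j).continuous_normSq

lemma inflow_nonneg (i : Fin (m + 1)) (x : M) : 0 ≤ inflow φ i x := by
  refine Fin.cases ?_ (fun j => ?_) i
  · exact le_rfl
  · exact (φ j).normSq_nonneg x

lemma outflow_nonneg (i : Fin (m + 1)) (x : M) : 0 ≤ outflow φ i x := by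
  refine Fin.lastCases ?_ (fun j => ?_) i
  · rw [outflow_last]
  · rw [outflow_castSucc]
    exact (φ j).normSq_nonneg x

lemma incoming_zero (x : M) : incoming φ 0 x = 0 := rfl

lemma incoming_succ (j : Fin m) (x : M) :
    incoming φ j.succ x = (φ j).toFun x ∘ₗ ((φ j).toFun x).adjoint := rfl

lemma outgoing_last (x : M) : outgoing φ (Fin.last m) x = 0 := by
  rw [outgoing, Fin.lastCases_last]

lemma outgoing_castSucc (j : Fin m) (x : M) :
    outgoing φ j.castSucc x = ((φ j).toFun x).adjoint ∘ₗ (φ j).toFun x := by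
  rw [outgoing, Fin.lastCases_castSucc]

/-- `tr φ φ* = tr φ* φ`: an arrow contributes the same function at its source and its target, which
makes the sum over the chain collapse. -/
lemma re_trace_incoming (i : Fin (m + 1)) (x : M) :
    (LinearMap.trace ℂ ((E i).Fiber x) (incoming φ i x)).re = inflow φ i x := by
  refine Fin.cases ?_ (fun j => ?_) i
  · rw [incoming_zero, inflow_zero, map_zero, Complex.zero_re]
  · rw [incoming_succ, inflow_succ, LinearMap.trace_comp_comm', BundleMorphism.normSq]

lemma re_trace_outgoing (i : Fin (m + 1)) (x : M) :
    (LinearMap.trace ℂ ((E i).Fiber x) (outgoing φ i x)).re = outflow φ i x := by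
  refine Fin.lastCases ?_ (fun j => ?_) i
  · rw [outgoing_last, outflow_last, map_zero, Complex.zero_re]
  · rw [outgoing_castSucc, outflow_castSucc, BundleMorphism.normSq]

lemma incoming_eq_zero {i : Fin (m + 1)} {x : M} : inflow φ i x = 0 → incoming φ i x = 0 := by
  refine Fin.cases (fun _ => rfl) (fun j h => ?_) i
  rw [incoming_succ, (φ j).toFun_eq_zero h, LinearMap.zero_comp]

lemma outgoing_eq_zero {i : Fin (m + 1)} {x : M} : outflow φ i x = 0 → outgoing φ i x = 0 := by
  refine Fin.lastCases (fun _ => outgoing_last φ x) (fun j h => ?_) i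
  rw [outflow_castSucc] at h
  rw [outgoing_castSucc, (φ j).toFun_eq_zero h, LinearMap.comp_zero]

end Flow

variable [IsManifold 𝓘(ℂ, V) ω M] [FiniteDimensional ℂ V]

section

variable {m : ℕ} {E : Fin (m + 1) → HermitianBundle.{u, v, w} V M} {g : KahlerMetric V M} {q : ℝ}
  {D : ∀ i, UnitaryConnection (E i)} {φ : ∀ j : Fin m, BundleMorphism (E j.castSucc) (E j.succ)}

lemma IsQVortex.isHermitianYangMills (h : IsQVortex g q D φ) {i : Fin (m + 1)}
    (hin : ∀ x, inflow φ i x = 0) (hout : ∀ x, outflow φ i x = 0) :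
    (D i).IsHermitianYangMills g (vortexConstant q m i) := fun x => by
  rw [h.vortex, incoming_eq_zero φ (hin x), outgoing_eq_zero φ (hout x), smul_zero, sub_zero,
    zero_add]

end

variable [MeasurableSpace V] [BorelSpace V] [T2Space M] [CompactSpace M]

namespace UnitaryConnection

variable {E : HermitianBundle.{u, v, w} V M} (B : UnitaryConnection E) {A : UnitaryConnection E}
  {g : KahlerMetric V M} {c : ℝ}

/-- The trace for `A` is a constant, so it is continuous and integrates at once; independence of the
connection passes the value to `B`. This carries the converse implications. -/
lemma topOne_of_isHermitianYangMills (hA : A.IsHermitianYangMills g c) :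
    B.topOne g = c * E.rank * g.vol := by
  have h : (fun x => (LinearMap.trace ℂ (E.Fiber x) (A.curvatureAlong g x)).re) =
      fun _ => c * E.rank := by
    funext x
    rw [hA x, _root_.map_smul, LinearMap.trace_id, E.finrank_fiber, smul_eq_mul,
      Complex.re_ofReal_mul, Complex.natCast_re]
  rw [B.topOne_eq_topOne A g (by rw [h]; exact continuous_const), topOne, h, g.integral_const]

lemma degree_of_isHermitianYangMills [Nonempty M] (hA : A.IsHermitianYangMills g c) :
    B.degree g = c * E.rank := by
  rw [degree, B.topOne_of_isHermitianYangMills hA, mul_div_cancel_right₀ _ g.vol_pos.ne']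

lemma slope_of_isHermitianYangMills [Nonempty M] (hE : 0 < E.rank)
    (hA : A.IsHermitianYangMills g c) : B.slope g = c := by
  have : (E.rank : ℝ) ≠ 0 := Nat.cast_ne_zero.2 hE.ne'
  rw [slope, B.degree_of_isHermitianYangMills hA, mul_div_cancel_right₀ _ this]

end UnitaryConnection

variable {m : ℕ} {E : Fin (m + 1) → HermitianBundle.{u, v, w} V M} {g : KahlerMetric V M} {q : ℝ}
  {D : ∀ i, UnitaryConnection (E i)} {φ : ∀ j : Fin m, BundleMorphism (E j.castSucc) (E j.succ)}

namespace IsQVortex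

/-- The traced vortex equation is integrated for `D i`. It also shows the integrand to be
continuous, so the result transfers to any `B`. -/
lemma degree_eq [Nonempty M] (h : IsQVortex g q D φ) {i : Fin (m + 1)}
    (B : UnitaryConnection (E i)) :
    B.degree g = vortexConstant q m i * (E i).rank +
      (q ^ 2 * g.integral (inflow φ i) - g.integral (outflow φ i)) / g.vol := by
  have h1 : (fun x => (LinearMap.trace ℂ ((E i).Fiber x) ((D i).curvatureAlong g x)).re) =
      fun x => (q ^ 2 * inflow φ i x + -1 * outflow φ i x) +
        vortexConstant q m i * (E i).rank := by
    funext x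
    rw [h.vortex, map_add, map_sub, map_smul, map_smul, LinearMap.trace_id, (E i).finrank_fiber,
      smul_eq_mul, smul_eq_mul, Complex.add_re, Complex.sub_re, Complex.re_ofReal_mul,
      Complex.re_ofReal_mul, Complex.natCast_re, re_trace_incoming, re_trace_outgoing]
    ring
  have hin : Continuous fun x => q ^ 2 * inflow φ i x :=
    continuous_const.mul (continuous_inflow φ i)
  have hout : Continuous fun x => -1 * outflow φ i x :=
    continuous_const.mul (continuous_outflow φ i)
  have hio : Continuous fun x => q ^ 2 * inflow φ i x + -1 * outflow φ i x := hin.add hout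
  have h2 : Continuous fun x =>
      (LinearMap.trace ℂ ((E i).Fiber x) ((D i).curvatureAlong g x)).re := by
    rw [h1]
    exact hio.add continuous_const
  rw [UnitaryConnection.degree, B.topOne_eq_topOne (D i) g h2, UnitaryConnection.topOne, h1,
    g.integral_add hio continuous_const, g.integral_add hin hout, g.integral_const_mul,
    g.integral_const_mul, g.integral_const]
  have := g.vol_pos.ne'
  field_simp
  ring

lemma slope_eq [Nonempty M] (h : IsQVortex g q D φ) {i : Fin (m + 1)}
    (hE : 0 < (E i).rank) (B : UnitaryConnection (E i)) :
    B.slope g = vortexConstant q m i +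
      (q ^ 2 * g.integral (inflow φ i) - g.integral (outflow φ i)) / (g.vol * (E i).rank) := by
  have : ((E i).rank : ℝ) ≠ 0 := Nat.cast_ne_zero.2 hE.ne'
  have := g.vol_pos.ne'
  rw [UnitaryConnection.slope, h.degree_eq]
  field_simp

/-- The constants cancel against the correction in the `(q, m)`-degree, and every arrow is counted
with `q²` at its target and `-1` at its source. -/
lemma qmDegree_eq [Nonempty M] (h : IsQVortex g q D φ) (B : ∀ i, UnitaryConnection (E i)) :
    qmDegree g q B = (q ^ 2 - 1) * (∑ j, g.integral (φ j).normSq) / g.vol := by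
  have hin : ∑ i, g.integral (inflow φ i) = ∑ j, g.integral (φ j).normSq := by
    have h0 : inflow φ 0 = fun _ => 0 := rfl
    have hs : ∀ j : Fin m, inflow φ j.succ = (φ j).normSq := fun j => rfl
    rw [Fin.sum_univ_succ, h0, g.integral_const, zero_mul, zero_add]
    simp only [hs]
  have hout : ∑ i, g.integral (outflow φ i) = ∑ j, g.integral (φ j).normSq := by
    rw [Fin.sum_univ_castSucc, funext (outflow_last φ), g.integral_const, zero_mul, add_zero]
    exact Finset.sum_congr rfl fun j _ => congrArg g.integral (funext (outflow_castSucc φ j))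
  have hi : ∀ i, (B i).degree g - vortexConstant q m i * (E i).rank =
      (q ^ 2 * g.integral (inflow φ i) - g.integral (outflow φ i)) / g.vol := fun i => by
    rw [h.degree_eq, add_sub_cancel_left]
  rw [qmDegree, Finset.sum_congr rfl fun i _ => hi i, ← Finset.sum_div, Finset.sum_sub_distrib,
    ← Finset.mul_sum, hin, hout, sub_mul, one_mul]

end IsQVortex

lemma vortexConstant_zero (q : ℝ) (m : ℕ) :
    vortexConstant q m (0 : Fin (m + 1)) = q ^ ((m : ℤ) + 1) * qNumber q m := by
  simp [vortexConstant]

lemma vortexConstant_last (q : ℝ) (m : ℕ) :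
    vortexConstant q m (Fin.last m) = -(q ^ (-(m : ℤ) + 1) * qNumber q m) := by
  have h : (m : ℤ) - 2 * m = -m := by ring
  rw [vortexConstant, Fin.val_last, h, qNumber, qNumber, neg_neg, ← neg_sub (q ^ (m : ℤ)), neg_div,
    mul_neg]

end

end

/-! ### The three inequalities and their equality cases. -/

theorem mainTheorem10
    {V : Type u} [NormedAddCommGroup V] [NormedSpace ℂ V] [FiniteDimensional ℂ V]
    [MeasurableSpace V] [BorelSpace V]
    {M : Type v} [TopologicalSpace M] [ChartedSpace V M] [IsManifold 𝓘(ℂ, V) ω M]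
    [T2Space M] [CompactSpace M] [ConnectedSpace M]
    (g : KahlerMetric V M) (q : ℝ) (hq₀ : 0 < q) (hq₁ : q < 1) (m : ℕ)
    (E : Fin (m + 1) → HermitianBundle.{u, v, w} V M)
    (hE₀ : 0 < (E 0).rank) (hEm : 0 < (E (Fin.last m)).rank)
    (D : ∀ i, UnitaryConnection (E i))
    (φ : ∀ j : Fin m, BundleMorphism (E j.castSucc) (E j.succ))
    (hvortex : IsQVortex g q D φ)
    -- arbitrary unitary connections, through which the degrees are computed
    (B : ∀ i, UnitaryConnection (E i)) :
    -- (a)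
    ((B 0).slope g ≤ q ^ ((m : ℤ) + 1) * qNumber q m ∧
      List.TFAE [
        (B 0).slope g = q ^ ((m : ℤ) + 1) * qNumber q m,
        (D 0).IsHermitianYangMills g (q ^ ((m : ℤ) + 1) * qNumber q m),
        ∃ A : UnitaryConnection (E 0), A.IsIntegrable ∧
          A.IsHermitianYangMills g (q ^ ((m : ℤ) + 1) * qNumber q m)]) ∧
    -- (b)
    (-(q ^ (-(m : ℤ) + 1) * qNumber q m) ≤ (B (Fin.last m)).slope g ∧
      List.TFAE [
        (B (Fin.last m)).slope g = -(q ^ (-(m : ℤ) + 1) * qNumber q m),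
        (D (Fin.last m)).IsHermitianYangMills g (-(q ^ (-(m : ℤ) + 1) * qNumber q m)),
        ∃ A : UnitaryConnection (E (Fin.last m)), A.IsIntegrable ∧
          A.IsHermitianYangMills g (-(q ^ (-(m : ℤ) + 1) * qNumber q m))]) ∧
    -- (c)
    (qmSlope g q B ≤ 0 ∧
      List.TFAE [
        qmSlope g q B = 0,
        ∀ i, (D i).IsHermitianYangMills g (vortexConstant q m i),
        ∀ i, ∃ A : UnitaryConnection (E i), A.IsIntegrable ∧
          A.IsHermitianYangMills g (vortexConstant q m i)]) := by
  have hV := g.vol_pos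
  have hq2 : q ^ 2 < 1 := pow_lt_one₀ hq₀.le hq₁ two_ne_zero
  refine ⟨?_, ?_, ?_⟩
  · rw [← vortexConstant_zero]
    have hP : 0 < g.vol * (E 0).rank := mul_pos hV (Nat.cast_pos.2 hE₀)
    have hin : g.integral (inflow φ 0) = 0 := by
      rw [funext (inflow_zero φ), g.integral_const, zero_mul]
    have hout := g.integral_nonneg (outflow_nonneg φ 0)
    have hs := hvortex.slope_eq hE₀ (B 0)
    rw [hin, mul_zero, zero_sub, neg_div, ← sub_eq_add_neg] at hs
    refine ⟨hs.trans_le (sub_le_self _ (div_nonneg hout hP.le)), ?_⟩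
    -- Equality forces the integral of the outgoing norm to vanish, hence the norm itself; there is
    -- no incoming field at the first vertex.
    tfae_have 1 → 2 := fun h1 => by
      rw [hs, sub_eq_self, div_eq_zero_iff, or_iff_left hP.ne'] at h1
      exact hvortex.isHermitianYangMills (inflow_zero φ)
        (g.eq_zero_of_integral_eq_zero (continuous_outflow φ 0) (outflow_nonneg φ 0) h1)
    tfae_have 2 → 3 := fun h2 => ⟨D 0, hvortex.integrable 0, h2⟩
    tfae_have 3 → 1 := fun ⟨_, _, hA⟩ => (B 0).slope_of_isHermitianYangMills hE₀ hA
    tfae_finish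
  · rw [← vortexConstant_last]
    have hP : 0 < g.vol * (E (Fin.last m)).rank := mul_pos hV (Nat.cast_pos.2 hEm)
    have hout : g.integral (outflow φ (Fin.last m)) = 0 := by
      rw [funext (outflow_last φ), g.integral_const, zero_mul]
    have hin := g.integral_nonneg (inflow_nonneg φ (Fin.last m))
    have hs := hvortex.slope_eq hEm (B (Fin.last m))
    rw [hout, sub_zero] at hs
    refine ⟨hs.symm ▸ le_add_of_nonneg_right (by positivity), ?_⟩
    tfae_have 1 → 2 := fun h1 => by
      rw [hs, add_eq_left, div_eq_zero_iff, or_iff_left hP.ne', mul_eq_zero,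
        or_iff_right (pow_pos hq₀ 2).ne'] at h1
      exact hvortex.isHermitianYangMills (g.eq_zero_of_integral_eq_zero
        (continuous_inflow φ (Fin.last m)) (inflow_nonneg φ (Fin.last m)) h1) (outflow_last φ)
    tfae_have 2 → 3 := fun h2 => ⟨D (Fin.last m), hvortex.integrable (Fin.last m), h2⟩
    tfae_have 3 → 1 := fun ⟨_, _, hA⟩ => (B (Fin.last m)).slope_of_isHermitianYangMills hEm hA
    tfae_finish
  -- Intermediate bundles may have rank zero; `E 0` alone makes the total rank positive.
  · have hR : 0 < ∑ i : Fin (m + 1), ((E i).rank : ℝ) :=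
      Finset.sum_pos' (fun i _ => Nat.cast_nonneg _) ⟨0, Finset.mem_univ 0, Nat.cast_pos.2 hE₀⟩
    have hφ : ∀ j, 0 ≤ g.integral (φ j).normSq := fun j => g.integral_nonneg (φ j).normSq_nonneg
    have hdeg := hvortex.qmDegree_eq B
    refine ⟨?_, ?_⟩
    · rw [qmSlope, hdeg]
      exact div_nonpos_of_nonpos_of_nonneg (div_nonpos_of_nonpos_of_nonneg
        (mul_nonpos_of_nonpos_of_nonneg (sub_nonpos.2 hq2.le) (Finset.sum_nonneg fun j _ => hφ j))
        hV.le) hR.le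
    -- Since `q² ≠ 1`, a zero slope makes the sum of the squared L² norms zero, so every Higgs field
    -- vanishes.
    tfae_have 1 → 2 := fun h1 i => by
      rw [qmSlope, hdeg, div_eq_zero_iff, or_iff_left hR.ne', div_eq_zero_iff, or_iff_left hV.ne',
        mul_eq_zero, or_iff_right (sub_neg.2 hq2).ne,
        Finset.sum_eq_zero_iff_of_nonneg fun j _ => hφ j] at h1
      have h0 : ∀ j x, (φ j).normSq x = 0 := fun j => g.eq_zero_of_integral_eq_zero
        (φ j).continuous_normSq (φ j).normSq_nonneg (h1 j (Finset.mem_univ j))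
      exact hvortex.isHermitianYangMills
        (fun x => Fin.cases (inflow_zero φ x) (fun j => h0 j x) i)
        (fun x => Fin.lastCases (outflow_last φ x)
          (fun j => (outflow_castSucc φ j x).trans (h0 j x)) i)
    tfae_have 2 → 3 := fun h2 i => ⟨D i, hvortex.integrable i, h2 i⟩
    tfae_have 3 → 1 := fun h3 => by
      rw [qmSlope, qmDegree, Finset.sum_eq_zero, zero_div]
      intro i _
      obtain ⟨_, _, hA⟩ := h3 i
      rw [(B i).degree_of_isHermitianYangMills hA, sub_self]
    tfae_finish
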